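/- **Model.** Fix integers $W\ge 0$ (back-off window) and $M\ge 0$, and reals $T>0$ (packet duration), $\sigma>0$ (mini-slot duration) and $\lambda>0$ (Poisson arrival rate at a station). For $r\in[0,1]$, a greedy station is the Markov chain $(K,N)$ on $\{(k,n): 0\le k\le W,\ n\ge 1\}\cup\{(0,0)\}$, where $k$ is the back-off counter and $n$ the number of packets, with the following steps. "Drawing a back-off with $n$ packets" means moving to $(0,0)$ if $n=0$, and to $(k,n)$ with $k$ uniform on $\{0,\dots,W\}$ if $n\ge1$. * From $(0,n)$, $n\ge1$: the slot has length $T$, one packet leaves, $j\sim\mathrm{Poisson}(\lambda T)$ packets arrive, and a back-off is drawn with $n-1+j$ packets. * From $(k,n)$, $k\ge1$: with probability $r$ the slot has length $T$ and the chain moves to $(k,n+j)$ with $j\sim\mathrm{Poisson}(\lambda T)$; with probability $1-r$ it has length $\sigma$ and the chain moves to $(k-1,n+j)$ with $j\sim\mathrm{Poisson}(\lambda\sigma)$. * From $(0,0)$: the slot has length $T$ with probability $r$ and $\sigma$ with probability $1-r$; a Poisson number $j$ of packets arrives (mean $\lambda T$, resp. $\lambda\sigma$) and a back-off is drawn with $j$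 packets. The chain is *ergodic* if from every initial state its law converges pointwise to one and the same strictly positive probability distribution $p(k,n)$. Consider a network of a tagged greedy station and $M$ other identical stations. It is *ergodic* (with busy probability $r$) if for some $r\in[0,1]$ the above chain is ergodic and $r=1-(1-\tau)^M$, where $\tau=\sum_{n\ge1}p(0,n)$. **Theorem.** 1. Suppose $\lambda T<1$. The equation $\lambda(T-\sigma)z^{M+1}-z+1-\lambda T=0$ has a unique root $z$ in $[0,1]$, and the network is ergodic if and only if $2z^{M+1}>W(1-z)$. Whenever the network is ergodic with busy probability $r$ and transmission probability $\tau$, one has $z=1-\tau$, and $z=(1-r)^{1/M}$ if $M\ge1$. 2. The equation $2u^{M+1}=W(1-u)$ has a unique root $u$ in $[0,1]$. For fixed $T,\sigma,W,M$, the maximum achievable throughput $\lambda_{\max}$, i.e. the supremum of the rates $\lambda>0$ for which the network is ergodic, is positive and given by $$\lambda_{\max}=\frac{1-u}{T(1-u^{M+1})+\sigma u^{M+1}}=\frac{1-u}{T+\frac{W(\sigma-T)(1-u)}{2}},$$ and for every $\lambda>0$ the network is ergodic if and only if $\lambda<\lambda_{\max}$. -/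

import Mathlib

open scoped Topology

noncomputable section

namespace GreedyBroadcast

/-- States `(K, N)` of a station: `K ∈ {0, …, W}` is the back-off counter and `N` the number of
packets waiting at the station. An empty station has no pending back-off, so the only state with
`N = 0` is `(0, 0)`. -/
abbrev State (W : ℕ) : Type :=
  {s : Fin (W + 1) × ℕ // s.2 = 0 → s.1 = 0}

/-- The state `(0, n)`. -/
def zeroBackoff (W n : ℕ) : State W :=
  ⟨(0, n), fun _ => rfl⟩

/-- Is the channel busy during the slot? `true` with probability `r`, `false` with probability
`1 - r`. -/
def busyLaw (r : unitInterval) : PMF Bool :=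
  (ProbabilityTheory.bernoulliMeasure true false r).toPMF

/-- Length of a slot: a normal slot has length `T`, a mini-slot has length `σ`. -/
def slotLength (T σ : ℝ) (busy : Bool) : ℝ :=
  if busy then T else σ

/-- Number of packets arriving at the station during a time interval of length `t ≥ 0`, for
Poisson arrivals of rate `lam ≥ 0`. -/
def arrivals (lam t : ℝ) : PMF ℕ :=
  (ProbabilityTheory.poissonMeasure (lam * t).toNNReal).toPMF

/-- A station left with `n` packets and without a running back-off: if `n = 0` it is idle,
otherwise it draws a new back-off counter uniformly in `{0, …, W}`. -/
def drawBackoff (W n : ℕ) : PMF (State W) :=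
  if h : n = 0 then PMF.pure (zeroBackoff W 0)
  else (PMF.uniformOfFintype (Fin (W + 1))).map fun k => ⟨(k, n), fun h0 => absurd h0 h⟩

/-- One step of the embedded chain `(K, N)` of a greedy station, when the channel is busy with
probability `r` in every slot that is not a transmission of this station.
* Idle station `(0, 0)`: the slot is normal or mini according to `busyLaw r`; if packets arrive
  during the slot, a back-off is drawn.
* `(0, n)` with `n ≥ 1`: one packet is transmitted, in a slot of length `T`; then a back-off is
  drawn for the next packet, if there is one.
* `(k, n)` with `k ≥ 1`: the slot is normal or mini according to `busyLaw r`; the counter is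
  unchanged in a normal slot and decremented by one in a mini-slot. -/
def step (lam T σ : ℝ) (r : unitInterval) (W : ℕ) (s : State W) : PMF (State W) :=
  if s.1.2 = 0 then
    (busyLaw r).bind fun busy =>
      (arrivals lam (slotLength T σ busy)).bind fun j => drawBackoff W j
  else if s.1.1 = 0 then
    (arrivals lam T).bind fun j => drawBackoff W (s.1.2 - 1 + j)
  else
    (busyLaw r).bind fun busy =>
      (arrivals lam (slotLength T σ busy)).map fun j =>
        ⟨(if busy then s.1.1 else ⟨s.1.1.val - 1, by omega⟩, s.1.2 + j), by
          intro h
          have h0 : s.1.2 = 0 := by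
            simp only at h
            omega
          have h1 := s.2 h0
          cases busy <;> simp [h1]⟩

/-- Law of the state after `i` steps of a Markov chain with one-step transition law `κ`,
started from `s`. -/
def lawAfter {S : Type*} (κ : S → PMF S) (s : S) : ℕ → PMF S
  | 0 => PMF.pure s
  | i + 1 => (lawAfter κ s i).bind κ

/-- The Markov chain with one-step transition law `κ` is ergodic with limit distribution `p`:
`p` is a probability distribution that charges every state, and for every initial state the
distribution after `i` steps converges to `p` as `i → ∞`. -/
def IsErgodicWithLimit {S : Type*} (κ : S → PMF S) (p : PMF S) : Prop :=
  (∀ x, 0 < p x) ∧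
    ∀ s x, Filter.Tendsto (fun i => lawAfter κ s i x) Filter.atTop (𝓝 (p x))

/-- The transmission probability `τ = ∑_{n ≥ 1} p(0, n)` under the distribution `p`. -/
def transmissionProb {W : ℕ} (p : PMF (State W)) : ℝ :=
  ∑' n : ℕ, (p (zeroBackoff W (n + 1))).toReal

/-- A stable regime of the greedy network of a tagged station and `M` other stations: the tagged
station sees a busy channel with probability `r`, its chain is ergodic with limit distribution
`p`, and `r` is the probability that at least one of `M` independent stations, each transmitting
with the same probability `τ` as the tagged one, transmits. -/
def IsStableRegime (lam T σ : ℝ) (W M : ℕ) (r : unitInterval) (p : PMF (State W)) : Prop :=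
  IsErgodicWithLimit (step lam T σ r W) p ∧ (r : ℝ) = 1 - (1 - transmissionProb p) ^ M

/-- The greedy broadcast network is ergodic. -/
def NetworkErgodic (lam T σ : ℝ) (W M : ℕ) : Prop :=
  ∃ (r : unitInterval) (p : PMF (State W)), IsStableRegime lam T σ W M r p

end GreedyBroadcast

end

/-! Two conservation laws of a stationary station give necessity, and a Lyapunov function gives
sufficiency.

Let `p` be stationary, `τ` its transmission probability and `s = rT + (1-r)σ` the mean length of a
slot in which the station does not transmit. Zero mean increment of the queue length gives `τ(1 -
λT) = (1-τ)λs` (`transmissionProb_balance`). Zero mean increment of the back-off counter, corrected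
at the idle state, gives `τW = 2(1-r)(1 - p(0,0) - τ)` (`backoff_balance`). With `z = 1-τ` and `1-r
= z^M`, the first law is the polynomial equation for `z`. Since `p(0,0) > 0`, the second becomes the
strict inequality `W(1-z) < 2z^(M+1)`.

Conversely, take the root `z` and put `r = 1 - z^M`. The inequality then says that fewer than one
packet arrives on average per service cycle, made of one transmission and about `W/2` countdowns. So
`n + bk` has negative drift for a suitable weight `b`, and `exp(θ(n + bk))` has geometric drift for
small `θ > 0`. A Harris-type theorem (`exists_isErgodicWithLimit_of_drift`) gives ergodicity: two
independent copies of the chain contract in a distance weighted by the Lyapunov function. The queue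
balance is linear in `τ`, which forces `τ = 1-z` and closes the fixed-point loop.

For the throughput, the inequality means `u < z`. The polynomial defining `z` is positive before its
root and negative after it, so this amounts to positivity at `u`, which is an affine condition on
`λ`. -/

open scoped Topology ENNReal NNReal
open Filter

noncomputable section

namespace GreedyBroadcast

/-! ### Expectations, stationary laws and contraction in a weighted distance -/

section

variable {α β S : Type*}

/-- Expectation of a nonnegative function under a probability mass function. -/
def expect (q : PMF α) (f : α → ℝ≥0∞) : ℝ≥0∞ := ∑' x, q x * f x

lemma expect_pure (a : α) (f : α → ℝ≥0∞) : expect (PMF.pure a) f = f a := by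
  classical
  rw [expect, tsum_eq_single a]
  · simp
  · intro b hb
    simp [PMF.pure_apply, hb]

lemma expect_bind (q : PMF α) (k : α → PMF β) (f : β → ℝ≥0∞) :
    expect (q.bind k) f = expect q fun a => expect (k a) f := by
  simp only [expect, PMF.bind_apply, ← ENNReal.tsum_mul_right, ← ENNReal.tsum_mul_left]
  rw [ENNReal.tsum_comm]
  simp only [mul_assoc]

lemma expect_map (q : PMF α) (g : α → β) (f : β → ℝ≥0∞) :
    expect (q.map g) f = expect q fun a => f (g a) := by
  rw [← PMF.bind_pure_comp, expect_bind]
  simp only [Function.comp, expect_pure]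

lemma expect_const (q : PMF α) (c : ℝ≥0∞) : expect q (fun _ => c) = c := by
  simp [expect, ENNReal.tsum_mul_right, q.tsum_coe]

lemma expect_add (q : PMF α) (f g : α → ℝ≥0∞) :
    expect q (fun a => f a + g a) = expect q f + expect q g := by
  simp [expect, mul_add, ENNReal.tsum_add]

lemma expect_const_mul (q : PMF α) (c : ℝ≥0∞) (f : α → ℝ≥0∞) :
    expect q (fun a => c * f a) = c * expect q f := by
  simp only [expect, ← ENNReal.tsum_mul_left]
  congr 1; ext a; ring

lemma expect_mono (q : PMF α) {f g : α → ℝ≥0∞} (h : ∀ a, f a ≤ g a) :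
    expect q f ≤ expect q g :=
  ENNReal.tsum_le_tsum fun a => by gcongr; exact h a

lemma mul_le_expect (q : PMF α) (f : α → ℝ≥0∞) (a : α) : q a * f a ≤ expect q f :=
  ENNReal.le_tsum a

lemma bind_apply_eq_expect (q : PMF α) (k : α → PMF β) (b : β) :
    q.bind k b = expect q fun a => k a b := rfl

lemma lawAfter_add (κ : S → PMF S) (s : S) (i j : ℕ) :
    lawAfter κ s (i + j) = (lawAfter κ s i).bind fun x => lawAfter κ x j := by
  induction j with
  | zero => simp [lawAfter]
  | succ j ih => rw [← add_assoc, lawAfter, ih, PMF.bind_bind]; rfl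

lemma lawAfter_one (κ : S → PMF S) (s : S) : lawAfter κ s 1 = κ s := by
  simp [lawAfter]

lemma lawAfter_mul_le (κ : S → PMF S) (s x y : S) (i j : ℕ) :
    lawAfter κ s i x * lawAfter κ x j y ≤ lawAfter κ s (i + j) y := by
  rw [lawAfter_add, bind_apply_eq_expect]
  exact mul_le_expect _ (fun x => lawAfter κ x j y) x

lemma lawAfter_self_ne_zero {κ : S → PMF S} {x : S} (h : κ x x ≠ 0) (n : ℕ) :
    lawAfter κ x n x ≠ 0 := by
  induction n with
  | zero => simp [lawAfter]
  | succ n ih =>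
    have h1 := lawAfter_mul_le κ x x x n 1
    rw [lawAfter_one] at h1
    exact fun h0 => mul_ne_zero ih h (le_antisymm (h1.trans h0.le) zero_le)

/-- A distribution to which the laws of the chain converge is stationary. -/
lemma bind_eq_of_tendsto {κ : S → PMF S} {p : PMF S} {s : S}
    (h : ∀ x, Tendsto (fun i => lawAfter κ s i x) atTop (𝓝 (p x))) : p.bind κ = p := by
  -- Fatou's inequality through finite partial sums. Both sides have total mass one, so domination
  -- forces equality.
  have hle : ∀ z, p.bind κ z ≤ p z := by
    intro z
    rw [PMF.bind_apply, ENNReal.tsum_eq_iSup_sum]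
    refine iSup_le fun F => ?_
    refine le_of_tendsto_of_tendsto
      (tendsto_finsetSum F fun x _ =>
        ENNReal.Tendsto.mul_const (h x) (Or.inr ((κ x).apply_ne_top z)))
      ((h z).comp (tendsto_add_atTop_nat 1)) (Eventually.of_forall fun n => ?_)
    exact ENNReal.sum_le_tsum F
  by_contra hne
  obtain ⟨z, hz⟩ : ∃ z, p.bind κ z ≠ p z := by
    by_contra! hall
    exact hne (PMF.ext hall)
  have := ENNReal.tsum_lt_tsum (PMF.tsum_coe_ne_top _) hle (lt_of_le_of_ne (hle z) hz)
  rw [PMF.tsum_coe, PMF.tsum_coe] at this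
  exact lt_irrefl _ this

lemma bind_lawAfter_eq {κ : S → PMF S} {p : PMF S} (h : p.bind κ = p) (n : ℕ) :
    (p.bind fun x => lawAfter κ x n) = p := by
  induction n with
  | zero => simp [lawAfter]
  | succ n ih => simp only [lawAfter]; rw [← PMF.bind_bind, ih, h]

/-- The support of a stationary law is nonempty and closed under reachability, and any two states
communicate through `x₀`. -/
lemma stationary_pos {κ : S → PMF S} {p : PMF S} (h : p.bind κ = p) (x₀ : S)
    (hto : ∀ x, ∃ n, lawAfter κ x n x₀ ≠ 0) (hfrom : ∀ x, ∃ n, lawAfter κ x₀ n x ≠ 0) (x : S) :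
    0 < p x := by
  have key : ∀ x y n, p x ≠ 0 → lawAfter κ x n y ≠ 0 → p y ≠ 0 := by
    intro x y n hx hy h0
    have h1 := mul_le_expect p (fun x => lawAfter κ x n y) x
    rw [← bind_apply_eq_expect, bind_lawAfter_eq h, h0] at h1
    exact mul_ne_zero hx hy (le_antisymm h1 zero_le)
  obtain ⟨y, hy⟩ := p.support_nonempty
  obtain ⟨n, hn⟩ := hto y
  obtain ⟨k, hk⟩ := hfrom x
  exact pos_iff_ne_zero.2 (key x₀ x k (key y x₀ n hy hn) hk)

/-- Iterated geometric drift. -/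
lemma expect_lawAfter_le {κ : S → PMF S} {V : S → ℝ≥0} {γ K B : ℝ≥0}
    (hdrift : ∀ x, expect (κ x) (fun y => V y) ≤ γ * V x + K) (hB : γ * B + K ≤ B) (x : S) (n : ℕ) :
    expect (lawAfter κ x n) (fun y => V y) ≤ γ ^ n * V x + B := by
  induction n with
  | zero => simp [lawAfter, expect_pure]
  | succ n ih =>
    rw [lawAfter, expect_bind]
    calc expect (lawAfter κ x n) (fun a => expect (κ a) fun y => (V y : ℝ≥0∞))
        ≤ expect (lawAfter κ x n) (fun a => γ * V a + K) := expect_mono _ hdrift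
      _ = γ * expect (lawAfter κ x n) (fun a => V a) + K := by
        rw [expect_add, expect_const_mul, expect_const]
      _ ≤ γ * (γ ^ n * V x + B) + K := by gcongr
      _ = γ ^ (n + 1) * V x + (γ * B + K : ℝ≥0) := by push_cast; ring
      _ ≤ γ ^ (n + 1) * V x + B := by gcongr

/-- Weighted discrete distance attached to a Lyapunov function. -/
def weightedDist [DecidableEq S] (b : ℝ≥0) (V : S → ℝ≥0) (x y : S) : ℝ≥0 :=
  if x = y then 0 else 2 + b * (V x + V y)

/-- Under a geometric drift condition and a minorization on a sublevel set, the expected weighted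
distance of two independent copies of the chain contracts. -/
lemma exists_contraction [DecidableEq S] {Q : S → PMF S} {V : S → ℝ≥0} {γ B a R : ℝ≥0} {x₀ : S}
    (hγ : γ < 1) (hQ : ∀ x, expect (Q x) (fun y => V y) ≤ γ * V x + B) (ha : 0 < a)
    (hR : 4 * B + 4 ≤ R * (1 - γ)) (hmin : ∀ x, V x ≤ R → a ≤ Q x x₀) :
    ∃ b ρ : ℝ≥0, ρ < 1 ∧ ∀ x y, x ≠ y →
      expect (Q x) (fun u => expect (Q y) fun v => weightedDist b V u v) ≤
        ρ * weightedDist b V x y := by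
  -- The weight is so small that the drift constant `2bB` costs at most half of the gain `2a²` from
  -- both copies meeting at `x₀`.
  set b : ℝ≥0 := a ^ 2 / (2 * (B + 1)) with hb
  have hbpos : 0 < b := by positivity
  have hbB : b * B ≤ a ^ 2 / 2 := by
    rw [hb, div_mul_eq_mul_div, div_le_div_iff₀ (by positivity) (by positivity)]
    nlinarith [mul_nonneg (sq_nonneg a) (zero_le (a := B)), zero_le (a := a^2)]
  have hRreal : 4 * (B : ℝ) + 4 ≤ R * (1 - γ) := by
    have := NNReal.coe_le_coe.2 hR
    rwa [NNReal.coe_mul, NNReal.coe_sub hγ.le] at this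
  have hγ' : (γ : ℝ) < 1 := by exact_mod_cast hγ
  have hbB' : (b : ℝ) * B ≤ a ^ 2 / 2 := by exact_mod_cast hbB
  have hb0 : (0 : ℝ) < b := by exact_mod_cast hbpos
  have ha0 : (0 : ℝ) < a := by exact_mod_cast ha
  -- The contraction rate is `1 - δ`. The first bound keeps `1 - δ - γ` nonnegative, the second
  -- serves pairs with `V x + V y ≤ R`, the third the remaining pairs.
  set δ : ℝ := min (1 - γ) (min (a ^ 2 / 2) (2 * b / (2 + b * R))) with hδ
  have hδpos : 0 < δ := by
    refine lt_min (by linarith) (lt_min (by positivity) (by positivity))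
  have hδ1 : δ ≤ 1 - γ := min_le_left _ _
  have hδ2 : δ ≤ a ^ 2 / 2 := (min_le_right _ _).trans (min_le_left _ _)
  have hδ3 : δ * (2 + b * R) ≤ 2 * b := by
    have : δ ≤ 2 * b / (2 + b * R) := (min_le_right _ _).trans (min_le_right _ _)
    rwa [le_div_iff₀ (by positivity)] at this
  have hγ0 : (0 : ℝ) ≤ γ := γ.2
  obtain ⟨ρ, hρ⟩ : ∃ ρ : ℝ≥0, (ρ : ℝ) = 1 - δ :=
    ⟨(1 - δ).toNNReal, Real.coe_toNNReal _ (by linarith)⟩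
  refine ⟨b, ρ, by rw [← NNReal.coe_lt_coe, hρ]; simpa using hδpos, ?_⟩
  intro x y hxy
  set E := expect (Q x) (fun u => expect (Q y) fun v => (weightedDist b V u v : ℝ≥0∞)) with hE
  -- The distance vanishes on the diagonal, so the event that both copies sit at `x₀` saves at least
  -- 2 from the bound `2 + b(V u + V v)`.
  have hsum : E + 2 * (Q x x₀ * Q y x₀) ≤ (2 + b * (γ * (V x + V y) + 2 * B) : ℝ≥0) := by
    have h1 : Q x x₀ * Q y x₀ ≤ expect (Q x) (fun u => expect (Q y) fun v =>
        if u = x₀ ∧ v = x₀ then 1 else 0) := by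
      refine le_trans ?_ (mul_le_expect (Q x) _ x₀)
      gcongr
      refine le_trans ?_ (mul_le_expect (Q y) _ x₀)
      simp
    calc E + 2 * (Q x x₀ * Q y x₀)
        ≤ E + 2 * expect (Q x) (fun u => expect (Q y) fun v =>
          if u = x₀ ∧ v = x₀ then 1 else 0) := by gcongr
      _ = expect (Q x) (fun u => expect (Q y) fun v => (weightedDist b V u v : ℝ≥0∞) +
            2 * if u = x₀ ∧ v = x₀ then 1 else 0) := by
          rw [hE, ← expect_const_mul, ← expect_add]
          congr 1; ext u
          rw [← expect_const_mul, ← expect_add]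
      _ ≤ expect (Q x) (fun u => expect (Q y) fun v => (2 + b * V u) + b * (V v : ℝ≥0∞)) := by
          refine expect_mono _ fun u => expect_mono _ fun v => ?_
          unfold weightedDist
          by_cases huv : u = v
          · by_cases hu : u = x₀ ∧ v = x₀
            · rw [if_pos huv, if_pos hu]; simp [add_assoc]
            · rw [if_pos huv, if_neg hu]; simp
          · have : ¬ (u = x₀ ∧ v = x₀) := fun h => huv (h.1.trans h.2.symm)
            rw [if_neg huv, if_neg this]
            push_cast
            rw [mul_add]; simp [add_assoc]
      _ = 2 + b * expect (Q x) (fun u => V u) + b * expect (Q y) (fun v => V v) := by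
          simp only [expect_add, expect_const_mul, expect_const]
      _ ≤ 2 + b * (γ * V x + B) + b * (γ * V y + B) := by
          gcongr
          · exact hQ x
          · exact hQ y
      _ = (2 + b * (γ * (V x + V y) + 2 * B) : ℝ≥0) := by push_cast; ring
  have hEtop : E ≠ ⊤ := ne_top_of_le_ne_top ENNReal.coe_ne_top (le_trans le_self_add hsum)
  have hqx := ENNReal.coe_toNNReal ((Q x).apply_ne_top x₀)
  have hqy := ENNReal.coe_toNNReal ((Q y).apply_ne_top x₀)
  rw [← ENNReal.coe_toNNReal hEtop]
  rw [← ENNReal.coe_toNNReal hEtop, ← hqx, ← hqy] at hsum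
  norm_cast at hsum ⊢
  rw [weightedDist, if_neg hxy]
  rw [← NNReal.coe_le_coe] at hsum ⊢
  push_cast at hsum ⊢
  rw [hρ]
  have hVx : (0 : ℝ) ≤ V x := (V x).2
  have hVy : (0 : ℝ) ≤ V y := (V y).2
  have hR0 : (0 : ℝ) ≤ R := R.2
  have hB0 : (0 : ℝ) ≤ B := B.2
  -- Below level `R` the minorization gives the contraction; above it the drift alone suffices, by
  -- the choice of `R`.
  by_cases hs : V x + V y ≤ R
  · have hx : (a : ℝ) ≤ (Q x x₀).toReal := by
      have := hmin x (le_trans le_self_add hs)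
      exact ENNReal.toReal_mono ((Q x).apply_ne_top x₀) this
    have hy : (a : ℝ) ≤ (Q y x₀).toReal := by
      have := hmin y (le_trans le_add_self hs)
      exact ENNReal.toReal_mono ((Q y).apply_ne_top x₀) this
    have hxy2 : (a : ℝ) ^ 2 ≤ (Q x x₀).toReal * (Q y x₀).toReal := by
      rw [sq]; exact mul_le_mul hx hy ha0.le (ha0.le.trans hx)
    have h5 : (b : ℝ) * (V x + V y) * (1 - δ - γ) ≥ 0 :=
      mul_nonneg (mul_nonneg hb0.le (by linarith)) (by linarith)
    nlinarith
  · have hs' : (R : ℝ) ≤ V x + V y := by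
      have := (not_le.1 hs).le
      exact_mod_cast this
    have hq : (0 : ℝ) ≤ 2 * ((Q x x₀).toReal * (Q y x₀).toReal) := by positivity
    have h5 : (b : ℝ) * (V x + V y - R) * (1 - δ - γ) ≥ 0 :=
      mul_nonneg (mul_nonneg hb0.le (by linarith)) (by linarith)
    have h6 := mul_le_mul_of_nonneg_left hRreal hb0.le
    have h7 : (0 : ℝ) ≤ b * B := by positivity
    nlinarith

/-- Dual form of the contraction: averaging the Lipschitz bound over independent copies multiplies
the Lipschitz constant by `ρ`. -/
lemma expect_le_of_lipschitz [DecidableEq S] {Q : S → PMF S} {V : S → ℝ≥0} {b ρ : ℝ≥0}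
    (hQ : ∀ x y, x ≠ y → expect (Q x) (fun u => expect (Q y) fun v => weightedDist b V u v) ≤
        ρ * weightedDist b V x y) {φ : S → ℝ≥0∞} {C : ℝ≥0}
    (hφ : ∀ u v, φ u ≤ φ v + C * weightedDist b V u v) (x y : S) :
    expect (Q x) φ ≤ expect (Q y) φ + (C * ρ : ℝ≥0) * weightedDist b V x y := by
  by_cases hxy : x = y
  · subst hxy; exact le_self_add
  calc expect (Q x) φ = expect (Q x) (fun u => expect (Q y) fun _ => φ u) := by
        simp only [expect_const]
    _ ≤ expect (Q x) (fun u => expect (Q y) fun v => φ v + C * weightedDist b V u v) :=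
        expect_mono _ fun u => expect_mono _ fun v => hφ u v
    _ = expect (Q y) φ + C * expect (Q x) (fun u => expect (Q y) fun v => weightedDist b V u v) := by
        simp only [expect_add, expect_const_mul, expect_const]
    _ ≤ expect (Q y) φ + C * (ρ * weightedDist b V x y) := by gcongr; exact hQ x y hxy
    _ = _ := by push_cast; ring

/-- Probabilities are at most 1 and distinct points are at distance at least 2, so the probability
of hitting `z` is 1-Lipschitz in the initial state; each block of `m` steps then gains a factor `ρ`.
-/
lemma lawAfter_le_of_contraction [DecidableEq S] {κ : S → PMF S} {V : S → ℝ≥0} {b ρ : ℝ≥0} {m : ℕ}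
    (hQ : ∀ x y, x ≠ y → expect (lawAfter κ x m) (fun u => expect (lawAfter κ y m)
      fun v => weightedDist b V u v) ≤ ρ * weightedDist b V x y) (z x y : S) (i j : ℕ) :
    lawAfter κ x (m * i + j) z ≤
      lawAfter κ y (m * i + j) z + (ρ ^ i : ℝ≥0) * weightedDist b V x y := by
  induction i generalizing x y with
  | zero =>
    by_cases hxy : x = y
    · subst hxy; exact le_self_add
    · refine ((lawAfter κ x _).coe_le_one z).trans (le_trans ?_ le_add_self)
      rw [weightedDist, if_neg hxy]
      norm_cast
      simp only [pow_zero, one_mul]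
      exact le_trans (by norm_num) (le_self_add (a := (2 : ℝ≥0)))
  | succ i ih =>
    have h : ∀ x, lawAfter κ x (m * (i + 1) + j) z =
        expect (lawAfter κ x m) fun u => lawAfter κ u (m * i + j) z := by
      intro x
      rw [← bind_apply_eq_expect, ← lawAfter_add]
      congr 2; ring
    rw [h, h, pow_succ]
    exact expect_le_of_lipschitz hQ ih x y

end

/-! ### Ergodicity from geometric drift -/

section

variable {α β S : Type*}

/-- If a self-looping state can be reached from everywhere, it is charged uniformly over a finite
set of initial states after a suitable number of steps. -/
lemma exists_uniform_minorization {κ : S → PMF S} {x₀ : S} (hloop : κ x₀ x₀ ≠ 0)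
    (hto : ∀ x, ∃ n, lawAfter κ x n x₀ ≠ 0) {A : Set S} (hA : A.Finite) :
    ∃ m, m ≠ 0 ∧ ∃ a : ℝ≥0, 0 < a ∧ ∀ x ∈ A, (a : ℝ≥0∞) ≤ lawAfter κ x m x₀ := by
  choose t ht using hto
  obtain ⟨m, hm⟩ : ∃ m, ∀ x ∈ A, t x ≤ m := by
    obtain ⟨m, hm⟩ := (hA.image t).bddAbove
    exact ⟨m, fun x hx => hm ⟨x, hx, rfl⟩⟩
  -- Waiting at `x₀` through the loop brings all hitting times to one common value; `m + 1` keeps it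
  -- nonzero.
  have hpos : ∀ x ∈ A, lawAfter κ x (m + 1) x₀ ≠ 0 := by
    intro x hx h0
    have h1 := lawAfter_mul_le κ x x₀ x₀ (t x) (m + 1 - t x)
    rw [show t x + (m + 1 - t x) = m + 1 by have := hm x hx; omega, h0] at h1
    exact mul_ne_zero (ht x) (lawAfter_self_ne_zero hloop _) (le_antisymm h1 zero_le)
  refine ⟨m + 1, by omega, ?_⟩
  rcases A.eq_empty_or_nonempty with rfl | hne
  · exact ⟨1, one_pos, by simp⟩
  obtain ⟨y, hy, hmin⟩ := hA.exists_minimalFor (fun x => lawAfter κ x (m + 1) x₀) A hne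
  have htop := (lawAfter κ y (m + 1)).apply_ne_top x₀
  refine ⟨(lawAfter κ y (m + 1) x₀).toNNReal, ENNReal.toNNReal_pos (hpos y hy) htop, ?_⟩
  intro x hx
  rw [ENNReal.coe_toNNReal htop]
  rcases le_total (lawAfter κ x (m + 1) x₀) (lawAfter κ y (m + 1) x₀) with h | h
  · exact hmin hx h
  · exact h

lemma abs_toReal_sub_le {a b : ℝ≥0∞} {c : ℝ≥0} (ha : a ≠ ⊤) (hb : b ≠ ⊤) (h1 : a ≤ b + c)
    (h2 : b ≤ a + c) : |a.toReal - b.toReal| ≤ c := by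
  lift a to ℝ≥0 using ha
  lift b to ℝ≥0 using hb
  norm_cast at h1 h2
  rw [← NNReal.coe_le_coe] at h1 h2
  push_cast at h1 h2
  simp only [ENNReal.coe_toReal]
  rw [abs_le]
  constructor <;> linarith

lemma weightedDist_comm [DecidableEq S] (b : ℝ≥0) (V : S → ℝ≥0) (x y : S) :
    weightedDist b V x y = weightedDist b V y x := by
  simp [weightedDist, eq_comm, add_comm]

lemma weightedDist_le [DecidableEq S] (b : ℝ≥0) (V : S → ℝ≥0) (x y : S) :
    weightedDist b V x y ≤ 2 + b * (V x + V y) := by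
  unfold weightedDist; split_ifs <;> simp

/-- Contraction in expected weighted distance, together with a moment bound, makes the laws of the
chain converge to a limit which does not depend on the initial state. -/
lemma exists_limit_of_contraction [DecidableEq S] [Nonempty S] {κ : S → PMF S} {V : S → ℝ≥0}
    {b ρ B : ℝ≥0} {m : ℕ} (hm : m ≠ 0) (hρ : ρ < 1)
    (hV : ∀ x n, expect (lawAfter κ x n) (fun y => V y) ≤ V x + B)
    (hQ : ∀ x y, x ≠ y → expect (lawAfter κ x m) (fun u => expect (lawAfter κ y m)
      fun v => weightedDist b V u v) ≤ ρ * weightedDist b V x y) :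
    ∃ g : S → ℝ≥0∞, ∀ s z, Tendsto (fun i => lawAfter κ s i z) atTop (𝓝 (g z)) := by
  have hstep : ∀ z x y n, lawAfter κ x n z ≤
      lawAfter κ y n z + (ρ ^ (n / m) : ℝ≥0) * weightedDist b V x y := by
    intro z x y n
    have := lawAfter_le_of_contraction hQ z x y (n / m) (n % m)
    rwa [Nat.div_add_mod] at this
  have hpow : Tendsto (fun n : ℕ => (ρ : ℝ) ^ (n / m)) atTop (𝓝 0) :=
    (tendsto_pow_atTop_nhds_zero_of_lt_one ρ.2 (by exact_mod_cast hρ)).comp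
      (Nat.tendsto_div_const_atTop hm)
  have hcauchy : ∀ s z, CauchySeq fun n => (lawAfter κ s n z).toReal := by
    intro s z
    set D : ℝ≥0 := 2 + b * (V s + (V s + B)) with hD
    -- The law at time `N + k` is an average of laws at time `N` started from the position at time
    -- `k`. That position is at mean distance at most `D` from `s`, uniformly in `k`.
    have hbound : ∀ N k, |(lawAfter κ s (N + k) z).toReal - (lawAfter κ s N z).toReal| ≤
        (ρ ^ (N / m) * D : ℝ≥0) := by
      intro N k
      have hexp : lawAfter κ s (N + k) z =
          expect (lawAfter κ s k) fun x => lawAfter κ x N z := by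
        rw [← bind_apply_eq_expect, ← lawAfter_add, add_comm]
      have hdist : expect (lawAfter κ s k) (fun x => (weightedDist b V s x : ℝ≥0∞)) ≤ D := by
        calc expect (lawAfter κ s k) (fun x => (weightedDist b V s x : ℝ≥0∞))
            ≤ expect (lawAfter κ s k) (fun x => (2 + b * V s) + b * V x) := by
              refine expect_mono _ fun x => ?_
              have := weightedDist_le b V s x
              rw [mul_add, ← add_assoc] at this
              exact_mod_cast this
          _ = (2 + b * V s) + b * expect (lawAfter κ s k) (fun x => V x) := by
              rw [expect_add, expect_const_mul, expect_const]
          _ ≤ (2 + b * V s) + b * (V s + B) := by gcongr; exact hV s k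
          _ = D := by rw [hD]; push_cast; ring
      refine abs_toReal_sub_le (PMF.apply_ne_top _ _) (PMF.apply_ne_top _ _) ?_ ?_
      · rw [hexp]
        calc expect (lawAfter κ s k) (fun x => lawAfter κ x N z)
            ≤ expect (lawAfter κ s k) (fun x => lawAfter κ s N z +
                (ρ ^ (N / m) : ℝ≥0) * weightedDist b V s x) := by
              refine expect_mono _ fun x => ?_
              rw [weightedDist_comm]
              exact hstep z x s N
          _ = lawAfter κ s N z + (ρ ^ (N / m) : ℝ≥0) *
                expect (lawAfter κ s k) (fun x => (weightedDist b V s x : ℝ≥0∞)) := by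
              rw [expect_add, expect_const_mul, expect_const]
          _ ≤ _ := by rw [ENNReal.coe_mul]; gcongr
      · calc lawAfter κ s N z = expect (lawAfter κ s k) fun _ => lawAfter κ s N z := by
              rw [expect_const]
          _ ≤ expect (lawAfter κ s k) (fun x => lawAfter κ x N z +
                (ρ ^ (N / m) : ℝ≥0) * weightedDist b V s x) :=
              expect_mono _ fun x => hstep z s x N
          _ = lawAfter κ s (N + k) z + (ρ ^ (N / m) : ℝ≥0) *
                expect (lawAfter κ s k) (fun x => (weightedDist b V s x : ℝ≥0∞)) := by
              rw [expect_add, expect_const_mul, hexp]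
          _ ≤ _ := by rw [ENNReal.coe_mul]; gcongr
    refine cauchySeq_of_le_tendsto_0 (fun N => 2 * ((ρ : ℝ) ^ (N / m) * D)) ?_ ?_
    · intro n k N hn hk
      obtain ⟨i, rfl⟩ := Nat.exists_eq_add_of_le hn
      obtain ⟨j, rfl⟩ := Nat.exists_eq_add_of_le hk
      have h1 := hbound N i
      have h2 := hbound N j
      push_cast at h1 h2
      rw [Real.dist_eq]
      rw [abs_le] at *
      constructor <;> linarith [h1.1, h1.2, h2.1, h2.2]
    · simpa using (hpow.mul_const (D : ℝ)).const_mul 2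
  obtain ⟨s₀⟩ := ‹Nonempty S›
  choose l hl using fun z => cauchySeq_tendsto_of_complete (hcauchy s₀ z)
  refine ⟨fun z => ENNReal.ofReal (l z), fun s z => ?_⟩
  have hreal : Tendsto (fun n => (lawAfter κ s n z).toReal) atTop (𝓝 (l z)) := by
    have hdiff : Tendsto (fun n => (lawAfter κ s n z).toReal - (lawAfter κ s₀ n z).toReal) atTop
        (𝓝 0) := by
      refine squeeze_zero_norm (a := fun n => (ρ : ℝ) ^ (n / m) * weightedDist b V s s₀) ?_ ?_
      · intro n
        rw [Real.norm_eq_abs]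
        have := abs_toReal_sub_le (c := ρ ^ (n / m) * weightedDist b V s s₀)
          (PMF.apply_ne_top _ _) (PMF.apply_ne_top _ _)
          (by rw [ENNReal.coe_mul]; exact hstep z s s₀ n)
          (by rw [ENNReal.coe_mul, weightedDist_comm]; exact hstep z s₀ s n)
        exact_mod_cast this
      · simpa using hpow.mul_const (weightedDist b V s s₀ : ℝ)
    simpa using hdiff.add (hl z)
  have := (ENNReal.continuous_ofReal.tendsto (l z)).comp hreal
  refine this.congr fun n => ?_
  simp [ENNReal.ofReal_toReal (PMF.apply_ne_top _ _)]

/-- A moment bound along a function with finite sublevel sets makes the pointwise limit of the laws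
a probability distribution. -/
lemma tsum_limit_eq_one {κ : S → PMF S} {V : S → ℝ≥0} {s : S} {C : ℝ≥0} {g : S → ℝ≥0∞}
    (hV : ∀ n, expect (lawAfter κ s n) (fun y => V y) ≤ C) (hfin : ∀ R, {x | V x ≤ R}.Finite)
    (hg : ∀ z, Tendsto (fun i => lawAfter κ s i z) atTop (𝓝 (g z))) : ∑' z, g z = 1 := by
  classical
  refine le_antisymm ?_ ?_
  · rw [ENNReal.tsum_eq_iSup_sum]
    refine iSup_le fun F => le_of_tendsto (tendsto_finsetSum F fun z _ => hg z)
      (Eventually.of_forall fun n => ?_)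
    exact (ENNReal.sum_le_tsum F).trans (lawAfter κ s n).tsum_coe.le
  · refine ENNReal.le_of_forall_pos_le_add fun ε hε _ => ?_
    -- Tightness by Markov's inequality: the mass outside `F` is at most `εC/(C + 1)`. Taking `C +
    -- 1` avoids dividing by zero.
    set F := (hfin ((C + 1) / ε)).toFinset with hF
    have hn : ∀ n, 1 ≤ ∑ z ∈ F, lawAfter κ s n z + ε := by
      intro n
      calc (1 : ℝ≥0∞) = expect (lawAfter κ s n) fun _ => 1 := (expect_const _ _).symm
        _ ≤ expect (lawAfter κ s n) fun z => (if z ∈ F then 1 else 0) +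
              (ε / (C + 1) : ℝ≥0) * V z := by
            refine expect_mono _ fun z => ?_
            by_cases hz : z ∈ F
            · simp [hz]
            · have hz' : (C + 1) / ε < V z := by simpa [hF] using hz
              have h1 : 1 ≤ ε / (C + 1) * V z := by
                calc (1 : ℝ≥0) = ε / (C + 1) * ((C + 1) / ε) := by field_simp
                  _ ≤ _ := by gcongr
              simp only [hz, if_false, zero_add]
              exact_mod_cast h1
        _ = ∑ z ∈ F, lawAfter κ s n z +
              (ε / (C + 1) : ℝ≥0) * expect (lawAfter κ s n) fun z => V z := by
            rw [expect_add, expect_const_mul]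
            congr 1
            simp only [expect, mul_ite, mul_one, mul_zero]
            rw [tsum_eq_sum (s := F) (fun z hz => by simp [hz])]
            exact Finset.sum_congr rfl fun z hz => by simp [hz]
        _ ≤ ∑ z ∈ F, lawAfter κ s n z + (ε / (C + 1) : ℝ≥0) * C := by gcongr; exact hV n
        _ ≤ ∑ z ∈ F, lawAfter κ s n z + ε := by
            gcongr
            have : ε / (C + 1) * C ≤ ε := by
              rw [div_mul_eq_mul_div, div_le_iff₀ (by positivity)]
              gcongr
              exact le_self_add
            exact_mod_cast this
    have hlim : 1 ≤ ∑ z ∈ F, g z + ε :=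
      ge_of_tendsto ((tendsto_finsetSum F fun z _ => hg z).add_const (ε : ℝ≥0∞))
        (Eventually.of_forall hn)
    exact hlim.trans (by gcongr; exact ENNReal.sum_le_tsum F)

/-- A Markov chain with a geometric drift towards finite sets, and with a self-looping state which
communicates with every state, is ergodic. -/
theorem exists_isErgodicWithLimit_of_drift {κ : S → PMF S} {V : S → ℝ≥0} {γ K : ℝ≥0} {x₀ : S}
    (hγ : γ < 1) (hdrift : ∀ x, expect (κ x) (fun y => V y) ≤ γ * V x + K)
    (hfin : ∀ R, {x | V x ≤ R}.Finite) (hloop : κ x₀ x₀ ≠ 0)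
    (hto : ∀ x, ∃ n, lawAfter κ x n x₀ ≠ 0) (hfrom : ∀ x, ∃ n, lawAfter κ x₀ n x ≠ 0) :
    ∃ p, IsErgodicWithLimit κ p := by
  classical
  have hγ' : (γ : ℝ) < 1 := by exact_mod_cast hγ
  have hγ1 : (0 : ℝ) < ((1 - γ : ℝ≥0) : ℝ) := by
    rw [NNReal.coe_sub hγ.le]; simpa using hγ'
  have hγ2 : 0 < 1 - γ := by exact_mod_cast hγ1
  -- The fixed point of `B ↦ γB + K`. It bounds the drift constant for every number of steps, so the
  -- level `R` can be fixed before `m`.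
  set B : ℝ≥0 := K / (1 - γ) with hB
  have hBK : γ * B + K ≤ B := by
    have h1 : (1 - γ) * B = K := by rw [hB]; field_simp
    have h2 : γ * B + (1 - γ) * B = B := by
      rw [← add_mul, add_tsub_cancel_of_le hγ.le, one_mul]
    rw [h1] at h2
    exact h2.le
  have hV : ∀ x n, expect (lawAfter κ x n) (fun y => V y) ≤ γ ^ n * V x + B :=
    fun x n => expect_lawAfter_le hdrift hBK x n
  have hV' : ∀ x n, expect (lawAfter κ x n) (fun y => V y) ≤ V x + B := by
    intro x n
    refine (hV x n).trans ?_
    gcongr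
    have : γ ^ n * V x ≤ V x := mul_le_of_le_one_left' (pow_le_one' hγ.le n)
    exact_mod_cast this
  obtain ⟨m, hm, a, ha, hmin⟩ := exists_uniform_minorization hloop hto
    (hfin ((4 * B + 4) / (1 - γ)))
  obtain ⟨b, ρ, hρ, hQ⟩ := exists_contraction (Q := fun x => lawAfter κ x m) hγ
    (fun x => (hV x m).trans (by
      gcongr
      exact_mod_cast pow_le_of_le_one zero_le hγ.le hm)) ha
    (R := (4 * B + 4) / (1 - γ)) (by rw [div_mul_cancel₀ _ hγ2.ne']) hmin
  have : Nonempty S := ⟨x₀⟩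
  obtain ⟨g, hg⟩ := exists_limit_of_contraction hm hρ hV' hQ
  have hsum : ∑' z, g z = 1 := tsum_limit_eq_one (C := V x₀ + B)
    (fun n => by push_cast; exact hV' x₀ n) hfin (hg x₀)
  refine ⟨⟨g, hsum ▸ ENNReal.summable.hasSum⟩, ?_, hg⟩
  exact stationary_pos (bind_eq_of_tendsto (s := x₀) (hg x₀)) x₀ hto hfrom

end

/-! ### One-step expectations and reachability for the station -/

section

lemma expect_busyLaw (r : unitInterval) (f : Bool → ℝ≥0∞) :
    expect (busyLaw r) f = ENNReal.ofReal r * f true + ENNReal.ofReal (1 - r) * f false := by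
  have h1 : busyLaw r true = ENNReal.ofReal r := by
    rw [busyLaw, MeasureTheory.Measure.toPMF_apply,
      ProbabilityTheory.bernoulliMeasure_apply_of_mem_of_notMem _ (by simp) (by simp) (by simp)]
    simp [ENNReal.ofReal, unitInterval.toNNReal, Real.toNNReal_of_nonneg r.2.1]
    rfl
  have h2 : busyLaw r false = ENNReal.ofReal (1 - r) := by
    rw [busyLaw, MeasureTheory.Measure.toPMF_apply,
      ProbabilityTheory.bernoulliMeasure_apply_of_notMem_of_mem _ (by simp) (by simp) (by simp)]
    have h : (0 : ℝ) ≤ 1 - r := by linarith [r.2.2]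
    simp [ENNReal.ofReal, unitInterval.toNNReal, Real.toNNReal_of_nonneg h]
    rfl
  rw [expect, tsum_bool, h1, h2, add_comm]

lemma arrivals_apply {lam t : ℝ} (h : 0 ≤ lam * t) (j : ℕ) :
    arrivals lam t j =
      ENNReal.ofReal (Real.exp (-(lam * t)) * (lam * t) ^ j / (Nat.factorial j)) := by
  rw [arrivals, MeasureTheory.Measure.toPMF_apply, ProbabilityTheory.poissonMeasure_singleton,
    Real.coe_toNNReal _ h]

lemma expect_arrivals_exp {lam t : ℝ} (h : 0 ≤ lam * t) (θ : ℝ) :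
    expect (arrivals lam t) (fun j => ENNReal.ofReal (Real.exp (θ * j))) =
      ENNReal.ofReal (Real.exp (lam * t * (Real.exp θ - 1))) := by
  have hs : HasSum (fun j : ℕ => Real.exp (-(lam * t)) * (lam * t) ^ j / (Nat.factorial j) *
      Real.exp (θ * j)) (Real.exp (lam * t * (Real.exp θ - 1))) := by
    have := (NormedSpace.expSeries_div_hasSum_exp (lam * t * Real.exp θ)).mul_left
      (Real.exp (-(lam * t)))
    rw [← Real.exp_eq_exp_ℝ, ← Real.exp_add] at this
    convert! this using 1
    · ext j
      rw [mul_pow (lam * t), mul_comm θ, Real.exp_nat_mul]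
      ring
    · congr 1; ring
  rw [expect, ← hs.tsum_eq, ENNReal.ofReal_tsum_of_nonneg _ hs.summable]
  · congr 1; ext j
    rw [arrivals_apply h, ← ENNReal.ofReal_mul (by positivity)]
  · intro j; positivity

lemma expect_arrivals_cast {lam t : ℝ} (h : 0 ≤ lam * t) :
    expect (arrivals lam t) (fun j => (j : ℝ≥0∞)) = ENNReal.ofReal (lam * t) := by
  have hs : HasSum (fun j : ℕ => Real.exp (-(lam * t)) * (lam * t) ^ j / (Nat.factorial j) * j)
      (lam * t) := by
    -- The term `j = 0` vanishes, and after the shift `j + 1` cancels against the factorial, leaving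
    -- an exponential series.
    rw [← hasSum_nat_add_iff' 1]
    have := (NormedSpace.expSeries_div_hasSum_exp (lam * t)).mul_left
      (Real.exp (-(lam * t)) * (lam * t))
    rw [← Real.exp_eq_exp_ℝ] at this
    convert! this using 1
    · ext j
      rw [Nat.factorial_succ]
      push_cast
      field_simp
      ring
    · rw [mul_right_comm, ← Real.exp_add]; simp
  rw [expect, ← hs.tsum_eq, ENNReal.ofReal_tsum_of_nonneg _ hs.summable]
  · congr 1; ext j
    rw [arrivals_apply h, ENNReal.ofReal_mul (by positivity), ENNReal.ofReal_natCast]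
  · intro j; positivity

lemma arrivals_ne_zero {lam t : ℝ} (h : 0 < lam * t) (j : ℕ) : arrivals lam t j ≠ 0 := by
  rw [arrivals_apply h.le]
  simp only [ne_eq, ENNReal.ofReal_eq_zero, not_le]
  positivity

/-- A function on states given by a function of the back-off counter and of the queue length. -/
def onState {W : ℕ} (F : ℕ → ℕ → ℝ≥0∞) (s : State W) : ℝ≥0∞ := F s.1.1.val s.1.2

lemma expect_drawBackoff_zero (W : ℕ) (F : ℕ → ℕ → ℝ≥0∞) :
    expect (drawBackoff W 0) (onState F) = F 0 0 := by
  simp [drawBackoff, expect_pure, onState, zeroBackoff]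

lemma expect_drawBackoff_of_ne_zero (W : ℕ) {n : ℕ} (hn : n ≠ 0) (F : ℕ → ℕ → ℝ≥0∞) :
    expect (drawBackoff W n) (onState F) =
      ((W : ℝ≥0∞) + 1)⁻¹ * ∑ k ∈ Finset.range (W + 1), F k n := by
  rw [drawBackoff, dif_neg hn, expect_map, expect, tsum_fintype, ← Fin.sum_univ_eq_sum_range
    (fun k => F k n), Finset.mul_sum]
  simp [onState]

section step

variable (lam T σ : ℝ) (r : unitInterval) (W : ℕ)

lemma expect_step_idle (s : State W) (h : s.1.2 = 0) (F : ℕ → ℕ → ℝ≥0∞) :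
    expect (step lam T σ r W s) (onState F) =
      ENNReal.ofReal r * expect (arrivals lam T) (fun j => expect (drawBackoff W j) (onState F)) +
      ENNReal.ofReal (1 - r) *
        expect (arrivals lam σ) (fun j => expect (drawBackoff W j) (onState F)) := by
  rw [step, if_pos h]
  simp only [expect_bind, expect_busyLaw, slotLength]
  simp

lemma expect_step_transmit (s : State W) (h : s.1.2 ≠ 0) (h0 : s.1.1 = 0) (F : ℕ → ℕ → ℝ≥0∞) :
    expect (step lam T σ r W s) (onState F) =
      expect (arrivals lam T) (fun j => expect (drawBackoff W (s.1.2 - 1 + j)) (onState F)) := by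
  rw [step, if_neg h, if_pos h0, expect_bind]

lemma expect_step_backoff (s : State W) (h0 : s.1.1 ≠ 0) (F : ℕ → ℕ → ℝ≥0∞) :
    expect (step lam T σ r W s) (onState F) =
      ENNReal.ofReal r * expect (arrivals lam T) (fun j => F s.1.1.val (s.1.2 + j)) +
      ENNReal.ofReal (1 - r) *
        expect (arrivals lam σ) (fun j => F (s.1.1.val - 1) (s.1.2 + j)) := by
  have h : s.1.2 ≠ 0 := fun h => h0 (s.2 h)
  rw [step, if_neg h, if_neg h0]
  simp only [expect_bind, expect_busyLaw, slotLength, expect_map, onState]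
  simp

end step

section reach

variable {lam T σ : ℝ} {r : unitInterval} {W : ℕ}

lemma busyLaw_false_mem_support (hr : (r : ℝ) < 1) : false ∈ (busyLaw r).support := by
  intro h0
  have h := expect_busyLaw r fun b => if b then 0 else 1
  rw [expect, tsum_bool, h0] at h
  simp at h
  linarith

lemma mem_support_drawBackoff (x : State W) : x ∈ (drawBackoff W x.1.2).support := by
  obtain ⟨⟨k, n⟩, hx⟩ := x
  rw [drawBackoff]
  by_cases h : n = 0
  · subst h
    have hk : k = 0 := hx rfl
    subst hk
    simp [zeroBackoff]
  · rw [dif_neg h]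
    simp

/-- A mini-slot can bring any number of packets. This supplies both the loop at `(0, 0)` and access
from it to every state. -/
lemma step_idle_mem_support (hr : (r : ℝ) < 1) (hl : 0 < lam) (hσ : 0 < σ) (x : State W) :
    x ∈ (step lam T σ r W (zeroBackoff W 0)).support := by
  rw [step, if_pos (by simp [zeroBackoff]), PMF.mem_support_bind_iff]
  refine ⟨false, busyLaw_false_mem_support hr, ?_⟩
  rw [PMF.mem_support_bind_iff]
  refine ⟨x.1.2, ?_, mem_support_drawBackoff x⟩
  exact arrivals_ne_zero (by simpa [slotLength] using mul_pos hl hσ) _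

lemma step_transmit_mem_support (hl : 0 < lam) (hT : 0 < T) (n : ℕ) :
    zeroBackoff W n ∈ (step lam T σ r W (zeroBackoff W (n + 1))).support := by
  rw [step, if_neg (by simp [zeroBackoff]), if_pos (by simp [zeroBackoff]),
    PMF.mem_support_bind_iff]
  exact ⟨0, arrivals_ne_zero (mul_pos hl hT) _, mem_support_drawBackoff (zeroBackoff W n)⟩

lemma step_backoff_mem_support (hr : (r : ℝ) < 1) (hl : 0 < lam) (hσ : 0 < σ)
    (x y : State W) (hk : x.1.1.val = y.1.1.val + 1) (hn : x.1.2 = y.1.2) :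
    y ∈ (step lam T σ r W x).support := by
  have h0 : x.1.1 ≠ 0 := by
    intro h
    rw [h] at hk
    simp at hk
  have h : x.1.2 ≠ 0 := fun h => h0 (x.2 h)
  rw [step, if_neg h, if_neg h0, PMF.mem_support_bind_iff]
  refine ⟨false, busyLaw_false_mem_support hr, ?_⟩
  rw [PMF.mem_support_map_iff]
  refine ⟨0, arrivals_ne_zero (by simpa [slotLength] using mul_pos hl hσ) _, ?_⟩
  apply Subtype.ext
  apply Prod.ext
  · apply Fin.ext
    simp [hk]
  · simp [hn]

lemma lawAfter_succ_ne_zero {S : Type*} {κ : S → PMF S} {x y z : S} {n : ℕ}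
    (h : y ∈ (κ x).support) (hn : lawAfter κ y n z ≠ 0) : lawAfter κ x (1 + n) z ≠ 0 := by
  intro h0
  have h1 := lawAfter_mul_le κ x y z 1 n
  rw [lawAfter_one, h0] at h1
  exact mul_ne_zero h hn (le_antisymm h1 zero_le)

/-- Without arrivals, mini-slots bring the counter to zero, then successive transmissions that each
draw back-off zero empty the queue. -/
lemma exists_lawAfter_idle_ne_zero (hr : (r : ℝ) < 1) (hl : 0 < lam) (hT : 0 < T) (hσ : 0 < σ)
    (x : State W) : ∃ n, lawAfter (step lam T σ r W) x n (zeroBackoff W 0) ≠ 0 := by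
  obtain ⟨⟨⟨k, hk⟩, n⟩, hx⟩ := x
  have hzero : ∀ n, ∃ i, lawAfter (step lam T σ r W) (zeroBackoff W n) i (zeroBackoff W 0) ≠ 0 := by
    intro n
    induction n with
    | zero => exact ⟨0, by simp [lawAfter]⟩
    | succ n ih =>
      obtain ⟨i, hi⟩ := ih
      exact ⟨1 + i, lawAfter_succ_ne_zero (step_transmit_mem_support hl hT n) hi⟩
  induction k with
  | zero => exact hzero n
  | succ k ih =>
    have hn : n ≠ 0 := by
      intro h
      have := congrArg Fin.val (hx h)
      simp at this
    obtain ⟨i, hi⟩ := ih (by omega) fun h => absurd h hn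
    exact ⟨1 + i, lawAfter_succ_ne_zero (step_backoff_mem_support hr hl hσ _
      ⟨(⟨k, by omega⟩, n), fun h => absurd h hn⟩ rfl rfl) hi⟩

end reach

end

/-! ### Exponential Lyapunov function and stability of the station -/

section

lemma eventually_lt_of_hasDerivAt_neg {f : ℝ → ℝ} {f' : ℝ} (h : HasDerivAt f f' 0) (hf' : f' < 0) :
    ∀ᶠ θ in 𝓝[>] 0, f θ < f 0 := by
  have h1 := (hasDerivAt_iff_tendsto_slope.1 h).eventually (gt_mem_nhds hf')
  have h2 : ∀ᶠ θ in 𝓝[>] (0 : ℝ), slope f 0 θ < 0 :=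
    h1.filter_mono (nhdsWithin_mono _ fun x hx => ne_of_gt hx)
  filter_upwards [h2, self_mem_nhdsWithin] with θ hθ hpos
  rw [slope_def_field, sub_zero, div_neg_iff] at hθ
  have : (0 : ℝ) < θ := hpos
  rcases hθ with ⟨_, h⟩ | ⟨h, _⟩
  · linarith
  · linarith

lemma hasDerivAt_poisson_mgf (a : ℝ) :
    HasDerivAt (fun θ : ℝ => Real.exp (a * (Real.exp θ - 1))) a 0 := by
  have := (((Real.hasDerivAt_exp 0).sub_const 1).const_mul a).exp
  simpa using this

lemma sum_range_cast_mul (W : ℕ) (b : ℝ) :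
    ((W : ℝ) + 1)⁻¹ * ∑ k ∈ Finset.range (W + 1), b * (k : ℝ) = b * W / 2 := by
  have h : ∑ k ∈ Finset.range (W + 1), (k : ℝ) = W * (W + 1) / 2 := by
    induction W with
    | zero => simp
    | succ n ih => rw [Finset.sum_range_succ, ih]; push_cast; ring
  rw [← Finset.mul_sum, h]
  field_simp

/-- Exponential weights decreasing on average at each step: a linear drift condition yields a
geometric one. -/
lemma exists_exponential_drift {x y q b : ℝ} (W : ℕ)
    (h1 : q * x + (1 - q) * (y - b) < 0) (h2 : -1 + x + b * W / 2 < 0) :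
    ∃ θ : ℝ, 0 < θ ∧
      q * Real.exp (x * (Real.exp θ - 1)) +
        (1 - q) * (Real.exp (-(θ * b)) * Real.exp (y * (Real.exp θ - 1))) < 1 ∧
      Real.exp (-θ) * (Real.exp (x * (Real.exp θ - 1)) *
        (((W : ℝ) + 1)⁻¹ * ∑ k ∈ Finset.range (W + 1), Real.exp (θ * (b * k)))) < 1 := by
  have hlin : ∀ c : ℝ, HasDerivAt (fun θ : ℝ => Real.exp (θ * c)) c 0 := fun c => by
    simpa using ((hasDerivAt_id (0 : ℝ)).mul_const c).exp
  -- Both moment generating factors equal 1 at `θ = 0`, with the linear drifts as derivatives, so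
  -- they fall below 1 for small `θ > 0`.
  have d1 : HasDerivAt (fun θ : ℝ => q * Real.exp (x * (Real.exp θ - 1)) +
        (1 - q) * (Real.exp (θ * -b) * Real.exp (y * (Real.exp θ - 1))))
      (q * x + (1 - q) * (y - b)) 0 := by
    have := ((hasDerivAt_poisson_mgf x).const_mul q).add
      (((hlin (-b)).mul (hasDerivAt_poisson_mgf y)).const_mul (1 - q))
    convert! this using 1
    simp only [Real.exp_zero, sub_self, mul_zero, zero_mul, mul_one, one_mul]
    ring
  have d2 : HasDerivAt (fun θ : ℝ => Real.exp (θ * -1) * (Real.exp (x * (Real.exp θ - 1)) *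
        (((W : ℝ) + 1)⁻¹ * ∑ k ∈ Finset.range (W + 1), Real.exp (θ * (b * k)))))
      (-1 + x + b * W / 2) 0 := by
    have := (hlin (-1)).mul ((hasDerivAt_poisson_mgf x).mul
      ((HasDerivAt.fun_sum fun k (_ : k ∈ Finset.range (W + 1)) => hlin (b * k)).const_mul
        ((W : ℝ) + 1)⁻¹))
    convert! this using 1
    have hW : ((W : ℝ) + 1) ≠ 0 := by positivity
    rw [sum_range_cast_mul]
    simp [inv_mul_cancel₀ hW]
    ring
  have e1 := eventually_lt_of_hasDerivAt_neg d1 h1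
  have e2 := eventually_lt_of_hasDerivAt_neg d2 h2
  obtain ⟨θ, ⟨hθ1, hθ2⟩, hpos⟩ := ((e1.and e2).and self_mem_nhdsWithin).exists
  have hW : ((W : ℝ) + 1) ≠ 0 := by positivity
  refine ⟨θ, hpos, ?_, ?_⟩
  · simpa using hθ1
  · simpa [inv_mul_cancel₀ hW] using hθ2

variable {lam T σ : ℝ} {r : unitInterval} {W : ℕ}

/-- Exponential Lyapunov function of the counter and the queue length. -/
def expWeight (θ b : ℝ) (k n : ℕ) : ℝ≥0∞ := ENNReal.ofReal (Real.exp (θ * (n + b * k)))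

lemma expect_arrivals_expWeight {t : ℝ} (h : 0 ≤ lam * t) (θ b : ℝ) (k n : ℕ) :
    expect (arrivals lam t) (fun j => expWeight θ b k (n + j)) =
      ENNReal.ofReal (Real.exp (θ * (n + b * k)) * Real.exp (lam * t * (Real.exp θ - 1))) := by
  rw [ENNReal.ofReal_mul (by positivity), ← expect_arrivals_exp h, ← expect_const_mul]
  congr 1; ext j
  rw [expWeight, ← ENNReal.ofReal_mul (by positivity), ← Real.exp_add]
  congr 2; push_cast; ring

/-- Equality holds for `n ≠ 0`. For `n = 0` no counter is drawn, and the averaged factor is at least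
1. -/
lemma expect_drawBackoff_expWeight_le {θ b : ℝ} (hθ : 0 ≤ θ) (hb : 0 ≤ b) (n : ℕ) :
    expect (drawBackoff W n) (onState (expWeight θ b)) ≤
      ENNReal.ofReal (((W : ℝ) + 1)⁻¹ * ∑ k ∈ Finset.range (W + 1), Real.exp (θ * (b * k))) *
        expWeight θ b 0 n := by
  have hW : (0 : ℝ) < (W : ℝ) + 1 := by positivity
  by_cases hn : n = 0
  · subst hn
    rw [expect_drawBackoff_zero]
    refine le_mul_of_one_le_left' ?_
    rw [← ENNReal.ofReal_one]
    refine ENNReal.ofReal_le_ofReal ?_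
    rw [inv_mul_eq_div, le_div_iff₀ hW, one_mul]
    calc (W : ℝ) + 1 = ∑ k ∈ Finset.range (W + 1), (1 : ℝ) := by simp
      _ ≤ _ := Finset.sum_le_sum fun k _ => Real.one_le_exp (by positivity)
  · rw [expect_drawBackoff_of_ne_zero W hn, ENNReal.ofReal_mul (by positivity),
      ENNReal.ofReal_inv_of_pos hW, ENNReal.ofReal_add (by positivity) zero_le_one,
      ENNReal.ofReal_natCast, ENNReal.ofReal_one, mul_assoc,
      ENNReal.ofReal_sum_of_nonneg (fun k _ => by positivity), Finset.sum_mul]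
    refine le_of_eq ?_
    congr 1
    refine Finset.sum_congr rfl fun k _ => ?_
    rw [expWeight, expWeight, ← ENNReal.ofReal_mul (by positivity), ← Real.exp_add]
    congr 2; push_cast; ring

/-- `hA` governs countdown steps and `hB` transmissions; the idle state accounts for the additive
constant alone. -/
lemma expect_step_expWeight_le (hlT : 0 ≤ lam * T) (hlσ : 0 ≤ lam * σ) {θ b γ : ℝ} (hθ : 0 ≤ θ)
    (hb : 0 ≤ b) (hγ : 0 ≤ γ) {fT fσ avg : ℝ}
    (hfT : fT = Real.exp (lam * T * (Real.exp θ - 1)))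
    (hfσ : fσ = Real.exp (lam * σ * (Real.exp θ - 1)))
    (havg : avg = ((W : ℝ) + 1)⁻¹ * ∑ k ∈ Finset.range (W + 1), Real.exp (θ * (b * k)))
    (hA : r * fT + (1 - r) * (Real.exp (-(θ * b)) * fσ) ≤ γ)
    (hB : Real.exp (-θ) * (fT * avg) ≤ γ) (s : State W) :
    expect (step lam T σ r W s) (onState (expWeight θ b)) ≤
      ENNReal.ofReal γ * expWeight θ b s.1.1.val s.1.2 +
        ENNReal.ofReal (r * (avg * fT) + (1 - r) * (avg * fσ)) := by
  have hr0 : (0 : ℝ) ≤ r := r.2.1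
  have hr1 : (0 : ℝ) ≤ 1 - r := by linarith [r.2.2]
  have havg0 : 0 ≤ avg := by rw [havg]; positivity
  have hfT0 : 0 ≤ fT := by rw [hfT]; positivity
  have hfσ0 : 0 ≤ fσ := by rw [hfσ]; positivity
  have hdraw : ∀ {t : ℝ}, 0 ≤ lam * t → ∀ n,
      expect (arrivals lam t) (fun j => expect (drawBackoff W (n + j)) (onState (expWeight θ b))) ≤
        ENNReal.ofReal (avg * (Real.exp (θ * n) * Real.exp (lam * t * (Real.exp θ - 1)))) := by
    intro t ht n
    refine (expect_mono _ fun j => expect_drawBackoff_expWeight_le hθ hb _).trans ?_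
    rw [← havg, expect_const_mul, expect_arrivals_expWeight ht, ← ENNReal.ofReal_mul havg0]
    simp
  by_cases hn : s.1.2 = 0
  · rw [expect_step_idle _ _ _ _ _ _ hn]
    refine le_trans ?_ le_add_self
    have e1 := hdraw hlT 0
    rw [← hfT] at e1
    have e2 := hdraw hlσ 0
    rw [← hfσ] at e2
    simp only [zero_add, Nat.cast_zero, mul_zero, Real.exp_zero, one_mul] at e1 e2
    rw [ENNReal.ofReal_add (by positivity) (by positivity), ENNReal.ofReal_mul hr0,
      ENNReal.ofReal_mul hr1]
    gcongr
  · refine le_trans ?_ le_self_add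
    rw [expWeight, ← ENNReal.ofReal_mul hγ]
    by_cases hk : s.1.1 = 0
    · rw [expect_step_transmit _ _ _ _ _ _ hn hk]
      refine (hdraw hlT _).trans (ENNReal.ofReal_le_ofReal ?_)
      have hexp : Real.exp (θ * ((s.1.2 - 1 : ℕ) : ℝ)) = Real.exp (-θ) * Real.exp (θ * s.1.2) := by
        rw [← Real.exp_add, Nat.cast_sub (Nat.one_le_iff_ne_zero.2 hn)]
        congr 1; push_cast; ring
      rw [hexp, hk, ← hfT]
      simp only [Fin.val_zero, Nat.cast_zero, mul_zero, add_zero]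
      calc avg * (Real.exp (-θ) * Real.exp (θ * s.1.2) * fT)
            = Real.exp (-θ) * (fT * avg) * Real.exp (θ * s.1.2) := by
            ring
        _ ≤ γ * Real.exp (θ * s.1.2) := by gcongr
    · rw [expect_step_backoff _ _ _ _ _ _ hk, expect_arrivals_expWeight hlT,
        expect_arrivals_expWeight hlσ, ← ENNReal.ofReal_mul hr0, ← ENNReal.ofReal_mul hr1,
        ← ENNReal.ofReal_add (by positivity) (by positivity)]
      refine ENNReal.ofReal_le_ofReal ?_
      have hk1 : 1 ≤ s.1.1.val := by
        rw [Nat.one_le_iff_ne_zero]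
        exact fun h => hk (Fin.ext h)
      have hexp : Real.exp (θ * (s.1.2 + b * ((s.1.1.val - 1 : ℕ) : ℝ))) =
          Real.exp (-(θ * b)) * Real.exp (θ * (s.1.2 + b * s.1.1.val)) := by
        rw [← Real.exp_add, Nat.cast_sub hk1]
        congr 1; push_cast; ring
      rw [hexp, ← hfT, ← hfσ]
      set e := Real.exp (θ * (s.1.2 + b * s.1.1.val))
      calc _ = (r * fT + (1 - r) * (Real.exp (-(θ * b)) * fσ)) * e := by ring
        _ ≤ γ * e := by gcongr

/-- A saturated station that serves packets faster than they arrive is ergodic. -/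
theorem exists_isErgodicWithLimit_step (hl : 0 < lam) (hT : 0 < T) (hσ : 0 < σ) (hr : (r : ℝ) < 1)
    (hstab : lam * T + lam * (r * T + (1 - r) * σ) / (1 - r) * W / 2 < 1) :
    ∃ p, IsErgodicWithLimit (step lam T σ r W) p := by
  have hr0 : (0 : ℝ) ≤ r := r.2.1
  have hr1 : (0 : ℝ) < 1 - r := by linarith
  -- Mean number of arrivals while the counter drops by one, which takes `1/(1-r)` slots on average.
  set b₀ : ℝ := lam * (r * T + (1 - r) * σ) / (1 - r) with hb₀
  have hb₀' : (1 - r) * b₀ = lam * (r * T + (1 - r) * σ) := by rw [hb₀]; field_simp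
  have hb₀pos : 0 ≤ b₀ := by positivity
  -- Raising the weight by `ε` makes the countdown drift strictly negative. At a transmission it
  -- costs only `εW/2` of the available margin `ε(W + 1)`.
  set ε : ℝ := (1 - lam * T - b₀ * W / 2) / (W + 1) with hε
  have hεpos : 0 < ε := div_pos (by linarith) (by positivity)
  have hε' : ε * (W + 1) = 1 - lam * T - b₀ * W / 2 := by rw [hε]; field_simp
  have hW0 : (0 : ℝ) ≤ W := Nat.cast_nonneg W
  set b : ℝ := b₀ + ε with hb
  have hbpos : 0 ≤ b := by positivity
  have h1 : (r : ℝ) * (lam * T) + (1 - r) * (lam * σ - b) < 0 := by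
    rw [hb]
    linarith [mul_pos hr1 hεpos, hb₀', mul_add (1 - (r : ℝ)) b₀ ε]
  have h2 : -1 + lam * T + b * W / 2 < 0 := by
    rw [hb]; nlinarith [mul_nonneg hεpos.le hW0]
  obtain ⟨θ, hθ, hA, hB⟩ := exists_exponential_drift W h1 h2
  have hmax : ∀ x y : ℝ, x < 1 → y < 1 → ∃ γ : ℝ, 0 ≤ γ ∧ γ < 1 ∧ x ≤ γ ∧ y ≤ γ :=
    fun x y hx hy => ⟨max 0 (max x y), le_max_left _ _, max_lt one_pos (max_lt hx hy),
      le_max_of_le_right (le_max_left _ _), le_max_of_le_right (le_max_right _ _)⟩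
  obtain ⟨γ, hγ0, hγ1, hAγ, hBγ⟩ := hmax _ _ hA hB
  refine exists_isErgodicWithLimit_of_drift (κ := step lam T σ r W) (γ := γ.toNNReal)
    (V := fun s => (Real.exp (θ * (s.1.2 + b * s.1.1.val))).toNNReal)
    (x₀ := zeroBackoff W 0) ?_
    (expect_step_expWeight_le (mul_pos hl hT).le (mul_pos hl hσ).le hθ.le hbpos hγ0 rfl rfl rfl
      hAγ hBγ) ?_
    (step_idle_mem_support hr hl hσ _) (exists_lawAfter_idle_ne_zero hr hl hT hσ)
    (fun x => ⟨1, by rw [lawAfter_one]; exact step_idle_mem_support hr hl hσ x⟩)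
  · rw [← NNReal.coe_lt_coe, Real.coe_toNNReal _ hγ0]
    simpa using hγ1
  · intro R
    have hfin : {x : Fin (W + 1) × ℕ | x.2 ≤ ⌊(R : ℝ) / θ⌋₊}.Finite :=
      ((Set.finite_univ (α := Fin (W + 1))).prod (Set.finite_Iic ⌊(R : ℝ) / θ⌋₊)).subset
        fun x hx => ⟨Set.mem_univ _, hx⟩
    refine (hfin.preimage Subtype.val_injective.injOn).subset fun s hs => ?_
    have hs' : Real.exp (θ * (s.1.2 + b * s.1.1.val)) ≤ R := by
      exact Real.toNNReal_le_iff_le_coe.1 hs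
    change s.1.2 ≤ ⌊(R : ℝ) / θ⌋₊
    refine Nat.le_floor ?_
    rw [le_div_iff₀ hθ]
    have h3 : θ * (s.1.2 + b * s.1.1.val) + 1 ≤ _ :=
      Real.add_one_le_exp (θ * (s.1.2 + b * s.1.1.val))
    have h4 : 0 ≤ θ * (b * s.1.1.val) := by positivity
    nlinarith

end

/-! ### Conservation laws under a stationary distribution -/

section

variable {α S : Type*}

lemma expect_toReal (q : PMF α) {f : α → ℝ≥0∞} (hf : ∀ a, f a ≠ ⊤) :
    (expect q f).toReal = ∑' a, (q a).toReal * (f a).toReal := by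
  rw [expect, ENNReal.tsum_toReal_eq fun a => ENNReal.mul_ne_top (q.apply_ne_top a) (hf a)]
  simp only [ENNReal.toReal_mul]

lemma summable_mul_toReal (q : PMF α) {f : α → ℝ≥0∞} (hf : expect q f ≠ ⊤) :
    Summable fun a => (q a).toReal * (f a).toReal := by
  simpa only [ENNReal.toReal_mul] using ENNReal.summable_toReal hf

lemma summable_toReal (q : PMF α) : Summable fun a => (q a).toReal :=
  ENNReal.summable_toReal q.tsum_coe_ne_top

lemma tsum_toReal (q : PMF α) : ∑' a, (q a).toReal = 1 := by
  rw [← ENNReal.tsum_toReal_eq q.apply_ne_top, q.tsum_coe, ENNReal.toReal_one]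

lemma tendsto_expect_min (q : PMF α) {f : α → ℕ} (hf : expect q (fun a => (f a : ℝ≥0∞)) ≠ ⊤) :
    Tendsto (fun m : ℕ => (expect q fun a => ((min (f a) m : ℕ) : ℝ≥0∞)).toReal) atTop
      (𝓝 (expect q fun a => (f a : ℝ≥0∞)).toReal) := by
  have hs := summable_mul_toReal q hf
  rw [expect_toReal q fun a => ENNReal.natCast_ne_top _]
  simp_rw [expect_toReal q fun a => ENNReal.natCast_ne_top _]
  refine tendsto_tsum_of_dominated_convergence hs (fun a => ?_)
    (Eventually.of_forall fun m a => ?_)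
  · refine tendsto_const_nhds.congr' ?_
    filter_upwards [eventually_ge_atTop (f a)] with m hm
    rw [min_eq_left hm]
  · rw [Real.norm_of_nonneg (by positivity)]
    gcongr
    · exact ENNReal.natCast_ne_top _
    · exact min_le_left _ _

/-- Under a stationary distribution, a bounded function has no mean increment. -/
lemma tsum_increment_eq_zero {κ : S → PMF S} {p : PMF S} (hp : p.bind κ = p) {f : S → ℝ≥0∞}
    {C : ℝ≥0} (hf : ∀ s, f s ≤ C) :
    ∑' s, (p s).toReal * ((expect (κ s) f).toReal - (f s).toReal) = 0 := by
  have hle : ∀ q : PMF S, expect q f ≤ C := fun q => (expect_mono q hf).trans (expect_const q _).le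
  have hne : ∀ q : PMF S, expect q f ≠ ⊤ := fun q => ne_top_of_le_ne_top ENNReal.coe_ne_top (hle q)
  have h1 : expect p (fun s => expect (κ s) f) = expect p f := by rw [← expect_bind, hp]
  have h2 := congrArg ENNReal.toReal h1
  rw [expect_toReal p fun s => hne _,
    expect_toReal p fun s => ne_top_of_le_ne_top ENNReal.coe_ne_top (hf s)] at h2
  simp_rw [mul_sub]
  rw [(summable_mul_toReal p (h1 ▸ hne p)).tsum_sub (summable_mul_toReal p (hne p)), h2, sub_self]

/-- Under a stationary distribution, a function with bounded mean increments of its truncations has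
no mean increment. -/
lemma tsum_increment_eq_zero_of_truncation {κ : S → PMF S} {p : PMF S} (hp : p.bind κ = p)
    {f : S → ℕ} (hf : ∀ s, expect (κ s) (fun x => (f x : ℝ≥0∞)) ≠ ⊤) {C : ℝ}
    (hC : ∀ s (m : ℕ), |(expect (κ s) fun x => ((min (f x) m : ℕ) : ℝ≥0∞)).toReal -
      (min (f s) m : ℕ)| ≤ C) :
    ∑' s, (p s).toReal * ((expect (κ s) fun x => (f x : ℝ≥0∞)).toReal - f s) = 0 := by
  -- The mean of `f` under `p` may be infinite, so stationarity is applied to `min f m`. The uniform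
  -- bound on increments then allows dominated convergence.
  have hlim : Tendsto (fun m : ℕ => ∑' s, (p s).toReal *
      ((expect (κ s) fun x => ((min (f x) m : ℕ) : ℝ≥0∞)).toReal - (min (f s) m : ℕ))) atTop
      (𝓝 (∑' s, (p s).toReal * ((expect (κ s) fun x => (f x : ℝ≥0∞)).toReal - f s))) := by
    refine tendsto_tsum_of_dominated_convergence ((summable_toReal p).mul_right C) (fun s => ?_)
      (Eventually.of_forall fun m s => ?_)
    · refine ((tendsto_expect_min (κ s) (hf s)).sub ?_).const_mul _
      refine tendsto_const_nhds.congr' ?_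
      filter_upwards [eventually_ge_atTop (f s)] with m hm
      rw [min_eq_left hm]
    · rw [norm_mul, Real.norm_of_nonneg ENNReal.toReal_nonneg]
      gcongr
      exact hC s m
  refine tendsto_nhds_unique hlim (tendsto_const_nhds.congr fun m => ?_)
  have := tsum_increment_eq_zero hp (f := fun x => ((min (f x) m : ℕ) : ℝ≥0∞)) (C := m)
    (fun s => by exact_mod_cast min_le_right _ _)
  simpa using this.symm

variable {lam T σ : ℝ} {r : unitInterval} {W : ℕ}

/-- Mean increments in the balance laws depend only on whether the station is idle, transmitting or
counting down. -/
lemma tsum_by_class (p : PMF (State W)) (x y z : ℝ) :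
    ∑' s : State W, (p s).toReal * (if s.1.2 = 0 then x else if s.1.1 = 0 then y else z) =
      (p (zeroBackoff W 0)).toReal * x + transmissionProb p * y +
        (1 - (p (zeroBackoff W 0)).toReal - transmissionProb p) * z := by
  have hsum := summable_toReal p
  have hind : ∀ (P : State W → Prop) [DecidablePred P],
      Summable fun s => if P s then (p s).toReal else 0 := fun P _ => by
    refine Summable.of_nonneg_of_le (fun s => ?_) (fun s => ?_) hsum
    · split_ifs <;> simp
    · split_ifs <;> simp
  have hidle : ∑' s : State W, (if s.1.2 = 0 then (p s).toReal else 0) =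
      (p (zeroBackoff W 0)).toReal := by
    rw [tsum_eq_single (zeroBackoff W 0)]
    · simp [zeroBackoff]
    · intro s hs
      rw [if_neg]
      intro h
      exact hs (Subtype.ext (Prod.ext (s.2 h) h))
  have htrans : ∑' s : State W, (if s.1.2 ≠ 0 ∧ s.1.1 = 0 then (p s).toReal else 0) =
      transmissionProb p := by
    have hinj : Function.Injective fun n : ℕ => zeroBackoff W (n + 1) := by
      intro m n h
      have := congrArg (fun s : State W => s.1.2) h
      simpa [zeroBackoff] using this
    rw [transmissionProb, ← hinj.tsum_eq]
    · simp [zeroBackoff]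
    · intro s hs
      have h : s.1.2 ≠ 0 ∧ s.1.1 = 0 := by
        by_contra h
        exact hs (if_neg h)
      exact ⟨s.1.2 - 1, Subtype.ext (Prod.ext h.2.symm (Nat.succ_pred_eq_of_ne_zero h.1))⟩
  have hdecomp : ∀ s : State W,
      (p s).toReal * (if s.1.2 = 0 then x else if s.1.1 = 0 then y else z) =
        (p s).toReal * z + (if s.1.2 = 0 then (p s).toReal else 0) * (x - z) +
          (if s.1.2 ≠ 0 ∧ s.1.1 = 0 then (p s).toReal else 0) * (y - z) := by
    intro s
    by_cases h1 : s.1.2 = 0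
    · simp only [h1, if_true, ne_eq, not_true_eq_false, false_and, if_false]; ring
    · by_cases h2 : s.1.1 = 0
      · simp only [h1, h2, if_true, if_false, ne_eq, not_false_eq_true, and_self]; ring
      · simp only [h1, h2, if_false, ne_eq, not_false_eq_true, and_false]; ring
  simp_rw [hdecomp]
  have s1 := hsum.mul_right z
  have s2 := (hind fun s => s.1.2 = 0).mul_right (x - z)
  have s3 := (hind fun s => s.1.2 ≠ 0 ∧ s.1.1 = 0).mul_right (y - z)
  rw [(s1.add s2).tsum_add s3, s1.tsum_add s2, tsum_mul_right, tsum_mul_right, tsum_mul_right,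
    tsum_toReal, hidle, htrans]
  ring

lemma transmissionProb_nonneg (p : PMF (State W)) : 0 ≤ transmissionProb p :=
  tsum_nonneg fun _ => ENNReal.toReal_nonneg

lemma idle_add_transmissionProb_le (p : PMF (State W)) :
    (p (zeroBackoff W 0)).toReal + transmissionProb p ≤ 1 := by
  have h := tsum_by_class p 0 0 1
  have h0 : 0 ≤ ∑' s : State W,
      (p s).toReal * (if s.1.2 = 0 then 0 else if s.1.1 = 0 then 0 else (1 : ℝ)) :=
    tsum_nonneg fun s => mul_nonneg ENNReal.toReal_nonneg (by split_ifs <;> norm_num)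
  linarith

lemma expect_drawBackoff_queue (n : ℕ) (f : ℕ → ℝ≥0∞) :
    expect (drawBackoff W n) (onState fun _ n => f n) = f n := by
  by_cases hn : n = 0
  · subst hn
    rw [expect_drawBackoff_zero]
  · rw [expect_drawBackoff_of_ne_zero W hn, Finset.sum_const, Finset.card_range, nsmul_eq_mul,
      ← mul_assoc]
    push_cast
    rw [ENNReal.inv_mul_cancel (by positivity) (by simp), one_mul]

lemma expect_step_queue_transmit (s : State W) (h : s.1.2 ≠ 0) (h0 : s.1.1 = 0) (f : ℕ → ℝ≥0∞) :
    expect (step lam T σ r W s) (fun s => f s.1.2) =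
      expect (arrivals lam T) fun j => f (s.1.2 - 1 + j) := by
  have := expect_step_transmit lam T σ r W s h h0 fun _ n => f n
  simp only [expect_drawBackoff_queue] at this
  exact this

lemma expect_step_queue_of_not_transmit (s : State W) (h : ¬ (s.1.2 ≠ 0 ∧ s.1.1 = 0))
    (f : ℕ → ℝ≥0∞) :
    expect (step lam T σ r W s) (fun s => f s.1.2) =
      ENNReal.ofReal r * expect (arrivals lam T) (fun j => f (s.1.2 + j)) +
        ENNReal.ofReal (1 - r) * expect (arrivals lam σ) (fun j => f (s.1.2 + j)) := by
  by_cases hn : s.1.2 = 0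
  · have := expect_step_idle lam T σ r W s hn fun _ n => f n
    simp only [expect_drawBackoff_queue] at this
    simp only [hn, zero_add]
    exact this
  · exact expect_step_backoff lam T σ r W s (fun h0 => h ⟨hn, h0⟩) fun _ n => f n

lemma expect_arrivals_add {t : ℝ} (h : 0 ≤ lam * t) (n : ℕ) :
    expect (arrivals lam t) (fun j => ((n + j : ℕ) : ℝ≥0∞)) = ENNReal.ofReal (n + lam * t) := by
  simp only [Nat.cast_add]
  rw [expect_add, expect_const, expect_arrivals_cast h, ENNReal.ofReal_add (by positivity) h,
    ENNReal.ofReal_natCast]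

lemma expect_arrivals_min_le {t : ℝ} (h : 0 ≤ lam * t) (n m : ℕ) :
    expect (arrivals lam t) (fun j => ((min (n + j) m : ℕ) : ℝ≥0∞)) ≤
      ENNReal.ofReal ((min n m : ℕ) + lam * t) := by
  rw [← expect_arrivals_add h]
  exact expect_mono _ fun j => by gcongr; omega

lemma le_expect_arrivals_min {t : ℝ} (n m : ℕ) :
    ENNReal.ofReal (min n m : ℕ) ≤
      expect (arrivals lam t) (fun j => ((min (n + j) m : ℕ) : ℝ≥0∞)) := by
  rw [ENNReal.ofReal_natCast, ← expect_const (arrivals lam t) (min n m : ℕ)]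
  exact expect_mono _ fun j => by gcongr; omega

lemma toReal_mix {a b : ℝ≥0∞} (ha : a ≠ ⊤) (hb : b ≠ ⊤) :
    (ENNReal.ofReal r * a + ENNReal.ofReal (1 - r) * b).toReal =
      r * a.toReal + (1 - r) * b.toReal := by
  rw [ENNReal.toReal_add (ENNReal.mul_ne_top ENNReal.ofReal_ne_top ha)
    (ENNReal.mul_ne_top ENNReal.ofReal_ne_top hb), ENNReal.toReal_mul, ENNReal.toReal_mul,
    ENNReal.toReal_ofReal r.2.1, ENNReal.toReal_ofReal (by linarith [r.2.2])]

lemma bounds_toReal {a : ℝ≥0∞} {x y : ℝ} (hy : 0 ≤ y) (h1 : ENNReal.ofReal x ≤ a)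
    (h2 : a ≤ ENNReal.ofReal y) : a ≠ ⊤ ∧ x ≤ a.toReal ∧ a.toReal ≤ y := by
  have ha : a ≠ ⊤ := ne_top_of_le_ne_top ENNReal.ofReal_ne_top h2
  exact ⟨ha, (ENNReal.ofReal_le_iff_le_toReal ha).1 h1, ENNReal.toReal_le_of_le_ofReal hy h2⟩

/-- In the stationary regime, packets leave the station at the rate at which they arrive. -/
theorem transmissionProb_balance (hlT : 0 ≤ lam * T) (hlσ : 0 ≤ lam * σ) {p : PMF (State W)}
    (hp : p.bind (step lam T σ r W) = p) :
    transmissionProb p * (1 - lam * T) =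
      (1 - transmissionProb p) * (lam * (r * T + (1 - r) * σ)) := by
  have hr0 : (0 : ℝ) ≤ r := r.2.1
  have hr1 : (0 : ℝ) ≤ 1 - r := by linarith [r.2.2]
  -- Back-off draws leave the queue unchanged, so its increment is the arrivals of the slot, minus
  -- one packet at a transmission.
  have hmean : ∀ s : State W, expect (step lam T σ r W s) (fun x => (x.1.2 : ℝ≥0∞)) ≠ ⊤ ∧
      (expect (step lam T σ r W s) (fun x => (x.1.2 : ℝ≥0∞))).toReal - s.1.2 =
        if s.1.2 = 0 then lam * (r * T + (1 - r) * σ)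
        else if s.1.1 = 0 then lam * T - 1 else lam * (r * T + (1 - r) * σ) := by
    intro s
    by_cases h : s.1.2 ≠ 0 ∧ s.1.1 = 0
    · rw [expect_step_queue_transmit s h.1 h.2 (fun n => (n : ℝ≥0∞)), expect_arrivals_add hlT,
        if_neg h.1, if_pos h.2]
      refine ⟨ENNReal.ofReal_ne_top, ?_⟩
      rw [ENNReal.toReal_ofReal (by positivity), Nat.cast_sub (Nat.one_le_iff_ne_zero.2 h.1)]
      push_cast; ring
    · rw [expect_step_queue_of_not_transmit s h (fun n => (n : ℝ≥0∞)), expect_arrivals_add hlT,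
        expect_arrivals_add hlσ]
      refine ⟨by finiteness, ?_⟩
      rw [toReal_mix ENNReal.ofReal_ne_top ENNReal.ofReal_ne_top,
        ENNReal.toReal_ofReal (by positivity), ENNReal.toReal_ofReal (by positivity)]
      have : (if s.1.2 = 0 then lam * (r * T + (1 - r) * σ)
        else if s.1.1 = 0 then lam * T - 1 else lam * (r * T + (1 - r) * σ)) =
          lam * (r * T + (1 - r) * σ) := by
        by_cases hn : s.1.2 = 0
        · rw [if_pos hn]
        · rw [if_neg hn, if_neg fun h0 => h ⟨hn, h0⟩]
      rw [this]; ring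
  have hbal := tsum_increment_eq_zero_of_truncation hp (f := fun s : State W => s.1.2)
    (fun s => (hmean s).1) (C := lam * T + lam * σ + 1) ?_
  · rw [tsum_congr fun s => by rw [(hmean s).2], tsum_by_class] at hbal
    linarith
  · intro s m
    by_cases h : s.1.2 ≠ 0 ∧ s.1.1 = 0
    · rw [expect_step_queue_transmit s h.1 h.2 (fun n => ((min n m : ℕ) : ℝ≥0∞))]
      obtain ⟨-, h1, h2⟩ := bounds_toReal (by positivity)
        (le_expect_arrivals_min (lam := lam) (t := T) (s.1.2 - 1) m)
        (expect_arrivals_min_le hlT (s.1.2 - 1) m)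
      have h3 : ((min s.1.2 m : ℕ) : ℝ) ≤ (min (s.1.2 - 1) m : ℕ) + 1 := by
        exact_mod_cast (by omega : min s.1.2 m ≤ min (s.1.2 - 1) m + 1)
      have h4 : ((min (s.1.2 - 1) m : ℕ) : ℝ) ≤ (min s.1.2 m : ℕ) := by
        exact_mod_cast (by omega : min (s.1.2 - 1) m ≤ min s.1.2 m)
      rw [abs_le]
      constructor <;> linarith
    · rw [expect_step_queue_of_not_transmit s h (fun n => ((min n m : ℕ) : ℝ≥0∞))]
      obtain ⟨ha, h1, h2⟩ := bounds_toReal (by positivity)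
        (le_expect_arrivals_min (lam := lam) (t := T) s.1.2 m)
        (expect_arrivals_min_le hlT s.1.2 m)
      obtain ⟨hb, h3, h4⟩ := bounds_toReal (by positivity)
        (le_expect_arrivals_min (lam := lam) (t := σ) s.1.2 m)
        (expect_arrivals_min_le hlσ s.1.2 m)
      rw [toReal_mix ha hb, abs_le]
      constructor <;> nlinarith [mul_le_mul_of_nonneg_left h1 hr0, mul_le_mul_of_nonneg_left h2 hr0,
        mul_le_mul_of_nonneg_left h3 hr1, mul_le_mul_of_nonneg_left h4 hr1,
        mul_nonneg hr0 hlσ, mul_nonneg hr1 hlT]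

/-- In the stationary regime, back-off counters decrease at the rate at which they are drawn. -/
theorem backoff_balance {p : PMF (State W)} (hp : p.bind (step lam T σ r W) = p) :
    transmissionProb p * W =
      2 * (1 - r) * (1 - (p (zeroBackoff W 0)).toReal - transmissionProb p) := by
  -- Twice the counter averages `W` after a genuine draw. Giving the idle state the value `W` makes
  -- this true of every draw, so the idle state has zero drift.
  set F : ℕ → ℕ → ℝ≥0∞ := fun k n => ((2 * k + if n = 0 then W else 0 : ℕ) : ℝ≥0∞) with hF
  have hdraw : ∀ n, expect (drawBackoff W n) (onState F) = W := by
    intro n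
    by_cases hn : n = 0
    · subst hn
      rw [expect_drawBackoff_zero]
      simp [hF]
    · rw [expect_drawBackoff_of_ne_zero W hn]
      have h : ∑ k ∈ Finset.range (W + 1), F k n = (((W + 1) * W : ℕ) : ℝ≥0∞) := by
        rw [← Nat.cast_sum]
        congr 1
        simp only [hn, if_false, add_zero]
        have := Finset.sum_range_id_mul_two (W + 1)
        rw [← Finset.mul_sum, mul_comm]
        simpa using this
      rw [h]
      push_cast
      rw [← mul_assoc, ENNReal.inv_mul_cancel (by positivity) (by simp), one_mul]
  have hbal := tsum_increment_eq_zero hp (f := onState F) (C := 3 * W) ?_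
  · have hinc : ∀ s : State W, (expect (step lam T σ r W s) (onState F)).toReal -
        (onState F s).toReal =
        if s.1.2 = 0 then 0 else if s.1.1 = 0 then (W : ℝ) else -(2 * (1 - r)) := by
      intro s
      by_cases hn : s.1.2 = 0
      · rw [expect_step_idle _ _ _ _ _ _ hn, if_pos hn]
        simp only [hdraw, expect_const]
        rw [toReal_mix (ENNReal.natCast_ne_top _) (ENNReal.natCast_ne_top _)]
        simp [onState, hF, hn, s.2 hn]
        ring
      · rw [if_neg hn]
        by_cases hk : s.1.1 = 0
        · rw [expect_step_transmit _ _ _ _ _ _ hn hk, if_pos hk]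
          simp only [hdraw, expect_const]
          simp [onState, hF, hn, hk]
        · rw [expect_step_backoff _ _ _ _ _ _ hk, if_neg hk]
          have hk1 : 1 ≤ s.1.1.val := by
            rw [Nat.one_le_iff_ne_zero]
            exact fun h => hk (Fin.ext h)
          have hadd : ∀ j, s.1.2 + j ≠ 0 := fun j => by omega
          simp only [hF, hadd, if_false, add_zero, expect_const]
          rw [toReal_mix (ENNReal.natCast_ne_top _) (ENNReal.natCast_ne_top _)]
          simp only [onState, hn, if_false, add_zero, ENNReal.toReal_natCast]
          push_cast [Nat.cast_sub hk1]
          ring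
    rw [tsum_congr fun s => by rw [hinc s], tsum_by_class] at hbal
    linarith
  · intro s
    have h := s.1.1.isLt
    have : (2 * s.1.1.val + if s.1.2 = 0 then W else 0) ≤ 3 * W := by
      split_ifs <;> omega
    simp only [onState, hF]
    exact_mod_cast this

end

/-! ### Roots of the two polynomial equations, and stable regimes -/

section

/-- Convexity of the power: at `v` it lies below the chord from `w` to 1, with the denominator `1 -
w` cleared. -/
lemma pow_convex_bound {w v : ℝ} (hw : 0 ≤ w) (hwv : w ≤ v) (hv : v ≤ 1) (n : ℕ) :
    (1 - w) * v ^ n ≤ (1 - v) * w ^ n + (v - w) := by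
  induction n with
  | zero => simp
  | succ n ih =>
    have h1 : w ^ n ≤ 1 := pow_le_one₀ hw (hwv.trans hv)
    have h2 := mul_le_mul_of_nonneg_left ih (hw.trans hwv)
    have h3 : 0 ≤ (1 - v) * (v - w) * (1 - w ^ n) :=
      mul_nonneg (mul_nonneg (by linarith) (by linarith)) (by linarith)
    rw [pow_succ, pow_succ]
    nlinarith

/-- The polynomial `c z ^ (M + 1) - z + d` changes sign exactly once on `[0, 1]`. -/
lemma exists_sign_change (M : ℕ) {c d : ℝ} (hd : 0 < d) (hcd : c + d < 1) :
    ∃ z : ℝ, 0 < z ∧ z < 1 ∧ c * z ^ (M + 1) - z + d = 0 ∧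
      (∀ w, 0 ≤ w → w < z → 0 < c * w ^ (M + 1) - w + d) ∧
      ∀ w, z < w → w ≤ 1 → c * w ^ (M + 1) - w + d < 0 := by
  set g : ℝ → ℝ := fun z => c * z ^ (M + 1) - z + d with hg
  have hg0 : g 0 = d := by simp [hg]
  have hg1 : g 1 < 0 := by simp only [hg, one_pow]; linarith
  -- The sign of `c` is that of `T - σ` and is not fixed. For `c ≤ 0` the function decreases; for `c
  -- ≥ 0` it is convex, positive at 0 and negative at 1.
  have hmono : c ≤ 0 → ∀ w v, 0 ≤ w → w < v → g v < g w := by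
    intro hc w v hw hwv
    have h1 : w ^ (M + 1) ≤ v ^ (M + 1) := pow_le_pow_left₀ hw hwv.le _
    have h2 := mul_le_mul_of_nonpos_left h1 hc
    simp only [hg]
    linarith
  have hconv : 0 ≤ c → ∀ w v, 0 ≤ w → w ≤ v → v ≤ 1 →
      (1 - w) * g v ≤ (1 - v) * g w + (v - w) * g 1 := by
    intro hc w v hw hwv hv
    have h1 := mul_le_mul_of_nonneg_left (pow_convex_bound hw hwv hv (M + 1)) hc
    simp only [hg, one_pow]
    nlinarith
  obtain ⟨z, ⟨hz0, hz1⟩, hz⟩ : (0 : ℝ) ∈ g '' Set.Icc 0 1 :=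
    intermediate_value_Icc' zero_le_one (by fun_prop) ⟨hg1.le, by rw [hg0]; exact hd.le⟩
  have hz0' : 0 < z := lt_of_le_of_ne hz0 fun h => by rw [← h, hg0] at hz; exact hd.ne' hz
  have hz1' : z < 1 := lt_of_le_of_ne hz1 fun h => by rw [h] at hz; exact hg1.ne hz
  refine ⟨z, hz0', hz1', hz, fun w hw hwz => ?_, fun w hzw hw => ?_⟩
  · change 0 < g w
    rcases le_total c 0 with hc | hc
    · rw [← hz]; exact hmono hc w z hw hwz
    · have h := hconv hc w z hw hwz.le hz1
      rw [hz, mul_zero] at h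
      have h2 : (z - w) * g 1 < 0 := mul_neg_of_pos_of_neg (by linarith) hg1
      exact pos_of_mul_pos_right (by linarith : 0 < (1 - z) * g w) (by linarith)
  · change g w < 0
    rcases le_total c 0 with hc | hc
    · rw [← hz]; exact hmono hc z w hz0 hzw
    · have h := hconv hc z w hz0 hzw.le hw
      rw [hz, mul_zero, zero_add] at h
      have h2 : (w - z) * g 1 < 0 := mul_neg_of_pos_of_neg (by linarith) hg1
      exact neg_of_mul_neg_right (h.trans_lt h2) (by linarith)

/-- The equation `2 u ^ (M + 1) = W (1 - u)` has exactly one root in `[0, 1]`. -/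
lemma exists_saturation_root (W M : ℕ) :
    ∃ u : ℝ, 0 ≤ u ∧ u < 1 ∧ 2 * u ^ (M + 1) = W * (1 - u) ∧
      ∀ w : ℝ, 0 ≤ w → (W * (1 - w) < 2 * w ^ (M + 1) ↔ u < w) := by
  -- Strictly increasing on the nonnegative reals, from `-W` at 0 to 2 at 1; the root is 0 when `W =
  -- 0`.
  set f : ℝ → ℝ := fun u => 2 * u ^ (M + 1) - W * (1 - u) with hf
  have hmono : ∀ w v, 0 ≤ w → w < v → f w < f v := by
    intro w v hw hwv
    have h1 : w ^ (M + 1) < v ^ (M + 1) := pow_lt_pow_left₀ hwv hw (by omega)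
    have h2 : (W : ℝ) * (1 - v) ≤ W * (1 - w) := by gcongr
    simp only [hf]
    linarith
  obtain ⟨u, ⟨hu0, hu1⟩, hu⟩ : (0 : ℝ) ∈ f '' Set.Icc 0 1 :=
    intermediate_value_Icc zero_le_one (by fun_prop) ⟨by simp [hf], by simp [hf]⟩
  refine ⟨u, hu0, lt_of_le_of_ne hu1 ?_, sub_eq_zero.1 hu, fun w hw => ?_⟩
  · rintro rfl
    norm_num [hf] at hu
  · rw [← sub_pos]
    change 0 < f w ↔ u < w
    constructor
    · intro h
      by_contra! hwu
      rcases hwu.eq_or_lt with rfl | hlt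
      · exact h.ne' hu
      · linarith [hmono w u hw hlt]
    · intro h
      rw [← hu]
      exact hmono u w hu0 h

variable {lam T σ : ℝ} {W M : ℕ}

/-- Balance equations in a stable regime. -/
lemma IsStableRegime.balance (hl : 0 < lam) (hT : 0 < T) (hσ : 0 < σ) {r : unitInterval}
    {p : PMF (State W)} (h : IsStableRegime lam T σ W M r p) :
    0 < 1 - transmissionProb p ∧ 1 - transmissionProb p ≤ 1 ∧ lam * T < 1 ∧
      lam * (T - σ) * (1 - transmissionProb p) ^ (M + 1) - (1 - transmissionProb p) +
        (1 - lam * T) = 0 ∧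
      W * (1 - (1 - transmissionProb p)) < 2 * (1 - transmissionProb p) ^ (M + 1) := by
  obtain ⟨⟨hpos, hlim⟩, hr⟩ := h
  have hp := bind_eq_of_tendsto (hlim (zeroBackoff W 0))
  have hbal1 := transmissionProb_balance (mul_pos hl hT).le (mul_pos hl hσ).le hp
  have hbal2 := backoff_balance hp
  -- Positive idle mass gives both `z > 0` and the strictness of the stability inequality.
  have hπ : 0 < (p (zeroBackoff W 0)).toReal :=
    ENNReal.toReal_pos (hpos _).ne' (p.apply_ne_top _)
  have hsum := idle_add_transmissionProb_le p
  have hτ := transmissionProb_nonneg p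
  set τ := transmissionProb p
  set z := 1 - τ with hz
  have hτz : τ = 1 - z := by rw [hz]; ring
  have hz0 : 0 < z := by linarith
  have hr' : 1 - (r : ℝ) = z ^ M := by rw [hr]; ring
  have hslot : 0 < r * T + (1 - r) * σ := by
    have h0 := r.2.1
    have h1 : 0 < 1 - (r : ℝ) := by rw [hr']; positivity
    positivity
  refine ⟨hz0, by linarith, ?_, ?_, ?_⟩
  · have h1 : 0 < z * (lam * (r * T + (1 - r) * σ)) := by positivity
    rw [← hbal1] at h1
    linarith [pos_of_mul_pos_right h1 hτ]
  · have hrT : (r : ℝ) = 1 - z ^ M := by linarith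
    rw [hrT, hτz] at hbal1
    rw [pow_succ]
    linarith
  · have h1 : 0 < z ^ M * (p (zeroBackoff W 0)).toReal := by positivity
    rw [mul_assoc, hr', hτz] at hbal2
    rw [pow_succ]
    nlinarith

/-- The stability condition yields a stable regime whose transmission probability is `1 - z`. -/
lemma networkErgodic_of_lt (hl : 0 < lam) (hT : 0 < T) (hσ : 0 < σ) (hlT : lam * T < 1) {z : ℝ}
    (hz0 : 0 < z) (hz1 : z ≤ 1)
    (hz : lam * (T - σ) * z ^ (M + 1) - z + (1 - lam * T) = 0)
    (hlt : W * (1 - z) < 2 * z ^ (M + 1)) : NetworkErgodic lam T σ W M := by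
  have hpow : 0 < z ^ M := by positivity
  have hpow1 : z ^ M ≤ 1 := pow_le_one₀ hz0.le hz1
  obtain ⟨r, hr⟩ : ∃ r : unitInterval, (r : ℝ) = 1 - z ^ M :=
    ⟨⟨1 - z ^ M, by linarith, by linarith⟩, rfl⟩
  have hs : 0 < (r : ℝ) * T + (1 - r) * σ := by
    have h0 := r.2.1
    have h1 : 0 < 1 - (r : ℝ) := by linarith
    positivity
  have hroot : z * (lam * (r * T + (1 - r) * σ)) = (1 - z) * (1 - lam * T) := by
    rw [hr]
    rw [pow_succ] at hz
    linarith
  -- Using the root equation, the left side is `λT + (1 - λT)·W(1-z)/(2z^(M+1))`.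
  have hstab : lam * T + lam * (r * T + (1 - r) * σ) / (1 - r) * W / 2 < 1 := by
    have hr1 : 1 - (r : ℝ) = z ^ M := by rw [hr]; ring
    have hls : lam * (r * T + (1 - r) * σ) = (1 - z) * (1 - lam * T) / z := by
      rw [← hroot]; field_simp
    rw [hls, hr1]
    have h1 : (1 - z) * (1 - lam * T) / z / z ^ M * W / 2 =
        (1 - lam * T) * (W * (1 - z) / (2 * z ^ (M + 1))) := by
      rw [pow_succ]; field_simp
    have h2 : W * (1 - z) / (2 * z ^ (M + 1)) < 1 := by
      rwa [div_lt_one (by positivity)]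
    rw [h1]
    nlinarith
  obtain ⟨p, hp⟩ := exists_isErgodicWithLimit_step hl hT hσ (by linarith : (r : ℝ) < 1) hstab
  have hbal := transmissionProb_balance (mul_pos hl hT).le (mul_pos hl hσ).le
    (bind_eq_of_tendsto (hp.2 (zeroBackoff W 0)))
  -- For this `r`, both `1 - τ` and `z` solve the same linear balance equation, whose leading
  -- coefficient is positive.
  have hτ : 1 - transmissionProb p = z := by
    have h1 : (1 - transmissionProb p - z) *
        (1 - lam * T + lam * (r * T + (1 - r) * σ)) = 0 := by linarith
    have h2 : 0 < lam * (r * T + (1 - r) * σ) := mul_pos hl hs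
    rcases mul_eq_zero.1 h1 with h | h <;> linarith
  exact ⟨r, p, hp, by rw [hτ, hr]⟩

end

end GreedyBroadcast

end

/-! ### The ergodicity criterion and the maximum throughput -/

theorem mainTheorem2 (W M : ℕ) (T σ : ℝ) (hT : 0 < T) (hσ : 0 < σ) :
    (∀ lam : ℝ, 0 < lam → lam * T < 1 →
      ∃ z : ℝ,
        (z ∈ Set.Icc (0 : ℝ) 1 ∧ lam * (T - σ) * z ^ (M + 1) - z + (1 - lam * T) = 0) ∧
        (∀ z' ∈ Set.Icc (0 : ℝ) 1,
          lam * (T - σ) * z' ^ (M + 1) - z' + (1 - lam * T) = 0 → z' = z) ∧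
        (GreedyBroadcast.NetworkErgodic lam T σ W M ↔ (W : ℝ) * (1 - z) < 2 * z ^ (M + 1)) ∧
        (∀ (r : unitInterval) (p : PMF (GreedyBroadcast.State W)),
          GreedyBroadcast.IsStableRegime lam T σ W M r p →
            z = 1 - GreedyBroadcast.transmissionProb p ∧
            (M ≠ 0 → z = (1 - (r : ℝ)) ^ (1 / (M : ℝ))))) ∧
    (∃ u : ℝ,
      (u ∈ Set.Icc (0 : ℝ) 1 ∧ 2 * u ^ (M + 1) = (W : ℝ) * (1 - u)) ∧
      (∀ u' ∈ Set.Icc (0 : ℝ) 1, 2 * u' ^ (M + 1) = (W : ℝ) * (1 - u') → u' = u) ∧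
      ∃ lamMax : ℝ,
        0 < lamMax ∧
        IsLUB {lam : ℝ | 0 < lam ∧ GreedyBroadcast.NetworkErgodic lam T σ W M} lamMax ∧
        (∀ lam : ℝ, 0 < lam →
          (GreedyBroadcast.NetworkErgodic lam T σ W M ↔ lam < lamMax)) ∧
        lamMax = (1 - u) / (T * (1 - u ^ (M + 1)) + σ * u ^ (M + 1)) ∧
        lamMax = (1 - u) / (T + (W : ℝ) * (σ - T) * (1 - u) / 2)) := by
  have main : ∀ lam : ℝ, 0 < lam → lam * T < 1 → ∃ z : ℝ, 0 < z ∧ z < 1 ∧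
      lam * (T - σ) * z ^ (M + 1) - z + (1 - lam * T) = 0 ∧
      (∀ w, 0 ≤ w → w < z → 0 < lam * (T - σ) * w ^ (M + 1) - w + (1 - lam * T)) ∧
      (∀ w, z < w → w ≤ 1 → lam * (T - σ) * w ^ (M + 1) - w + (1 - lam * T) < 0) ∧
      (GreedyBroadcast.NetworkErgodic lam T σ W M ↔ (W : ℝ) * (1 - z) < 2 * z ^ (M + 1)) ∧
      ∀ r p, GreedyBroadcast.IsStableRegime lam T σ W M r p →
        z = 1 - GreedyBroadcast.transmissionProb p := by
    intro lam hl hlT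
    obtain ⟨z, hz0, hz1, hz, hlo, hhi⟩ := GreedyBroadcast.exists_sign_change M (c := lam * (T - σ))
      (d := 1 - lam * T) (by linarith) (by linarith [mul_pos hl hσ])
    have heq : ∀ r p, GreedyBroadcast.IsStableRegime lam T σ W M r p →
        z = 1 - GreedyBroadcast.transmissionProb p := by
      intro r p h
      obtain ⟨h0, h1, -, h2, -⟩ := h.balance hl hT hσ
      rcases lt_trichotomy z (1 - GreedyBroadcast.transmissionProb p) with h | h | h
      · exact absurd h2 (hhi _ h h1).ne
      · exact h
      · exact absurd h2 (hlo _ h0.le h).ne'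
    refine ⟨z, hz0, hz1, hz, hlo, hhi,
      ⟨?_, GreedyBroadcast.networkErgodic_of_lt hl hT hσ hlT hz0 hz1.le hz⟩, heq⟩
    rintro ⟨r, p, h⟩
    have := (h.balance hl hT hσ).2.2.2.2
    rwa [← heq r p h] at this
  refine ⟨fun lam hl hlT => ?_, ?_⟩
  · obtain ⟨z, hz0, hz1, hz, hlo, hhi, hiff, heq⟩ := main lam hl hlT
    refine ⟨z, ⟨⟨hz0.le, hz1.le⟩, hz⟩, fun w hw h => ?_, hiff, fun r p h => ⟨heq r p h, fun hM => ?_⟩⟩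
    · rcases lt_trichotomy z w with h' | h' | h'
      · exact absurd h (hhi _ h' hw.2).ne
      · exact h'.symm
      · exact absurd h (hlo _ hw.1 h').ne'
    · have hr : 1 - (r : ℝ) = z ^ M := by rw [h.2, ← heq r p h]; ring
      rw [hr, one_div, Real.pow_rpow_inv_natCast hz0.le hM]
  · obtain ⟨u, hu0, hu1, hu, hgt⟩ := GreedyBroadcast.exists_saturation_root W M
    have hpow : u ^ (M + 1) ≤ u := pow_le_of_le_one hu0 hu1.le (by omega)
    have hpow0 : 0 ≤ u ^ (M + 1) := pow_nonneg hu0 _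
    -- Besides `D > 0`, this shows `(1 - u)/D ≤ 1/T`, so rates with `λT ≥ 1` lie on the non-ergodic
    -- side.
    have hDT : T * (1 - u) ≤ T * (1 - u ^ (M + 1)) + σ * u ^ (M + 1) := by
      have := mul_le_mul_of_nonneg_left hpow hT.le
      have := mul_nonneg hσ.le hpow0
      linarith
    set D := T * (1 - u ^ (M + 1)) + σ * u ^ (M + 1) with hD
    have hTu : 0 < T * (1 - u) := mul_pos hT (by linarith)
    have hDpos : 0 < D := hTu.trans_le hDT
    have hpos : 0 < (1 - u) / D := div_pos (by linarith) hDpos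
    have herg : ∀ lam : ℝ, 0 < lam →
        (GreedyBroadcast.NetworkErgodic lam T σ W M ↔ lam < (1 - u) / D) := by
      intro lam hl
      rw [lt_div_iff₀ hDpos]
      by_cases hlT : lam * T < 1
      · obtain ⟨z, hz0, hz1, hz, hlo, hhi, hiff, -⟩ := main lam hl hlT
        rw [hiff, hgt z hz0.le]
        -- By the sign pattern around `z`, this value is positive exactly when `u < z`, which turns
        -- the criterion into `λD < 1 - u`.
        have hg : lam * (T - σ) * u ^ (M + 1) - u + (1 - lam * T) = 1 - u - lam * D := by
          rw [hD]; ring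
        constructor
        · intro h
          linarith [hlo u hu0 h]
        · intro h
          by_contra! hzu
          rcases hzu.eq_or_lt with h' | h'
          · rw [h'] at hz
            linarith
          · linarith [hhi u h' hu1.le]
      · constructor
        · rintro ⟨r, p, h⟩
          exact absurd (h.balance hl hT hσ).2.2.1 hlT
        · intro h
          have h1 := mul_le_mul_of_nonneg_left hDT hl.le
          have h2 : (1 - u) * 1 ≤ (1 - u) * (lam * T) :=
            mul_le_mul_of_nonneg_left (not_lt.1 hlT) (by linarith)
          linarith
    refine ⟨u, ⟨⟨hu0, hu1.le⟩, hu⟩, fun w hw h => ?_, (1 - u) / D, hpos, ?_, herg, rfl, ?_⟩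
    · rcases lt_trichotomy u w with h' | h' | h'
      · exact absurd h ((hgt w hw.1).2 h').ne'
      · exact h'.symm
      · have h1 : w ^ (M + 1) < u ^ (M + 1) := pow_lt_pow_left₀ h' hw.1 (by omega)
        have h2 : (W : ℝ) * (1 - u) ≤ W * (1 - w) := by gcongr
        linarith
    · have hset : {lam : ℝ | 0 < lam ∧ GreedyBroadcast.NetworkErgodic lam T σ W M} =
          Set.Ioo 0 ((1 - u) / D) := by
        ext lam
        exact and_congr_right fun hl => herg lam hl
      rw [hset]
      exact isLUB_Ioo hpos
    -- The two denominators agree after replacing `u^(M+1)` by `W(1-u)/2`.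
    · congr 1
      have hu' : u ^ (M + 1) = W * (1 - u) / 2 := by linarith
      rw [hD, hu']
      ring
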